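/- Let $n\ge 1$ and $k\ge 2$ be integers and let $q\in\mathbb C^\times$ be such that every integer $\ell\geq 1$ with $q^{2\ell}=1$ satisfies $\ell>k$. Put $\beta=q+q^{-1}$, $N=n+k$ and $[m]=(q^m-q^{-m})/(q-q^{-1})$. *Diagrams.* An $(a,b)$-diagram is a non-crossing perfect matching of $a$ points on the left side and $b$ points on the right side of a rectangle. Diagrams are composed by concatenation, each closed loop being replaced by a factor $\beta$; $\mathrm{TL}_N(\beta)$ is the algebra of complex linear combinations of $(N,N)$-diagrams. The generator $E_i$ ($1\le i<N$) joins the $i$-th and $(i+1)$-st points from the top on each side and joins every other point to the one facing it. The $k$ bottom points on a side of an $(N,N)$-diagram, or on the left side of an $(N,d)$-diagram, are its boundary points, and the $n$ others its bulk points. An $(N,d)$-diagram is monic if all its $d$ right points are joined to left points. Let $D^*$ be the left-right mirror image of $D$. *Seam algebra.* Let $P_1=\mathrm{Id}$ and $P_j=P_{j-1}-\frac{[j-1]}{[j]}P_{j-1}E_{N-j+1}P_{j-1}$ for $2\le j\le k$ (Wenzl–Jones projectors on the bottom $j$ points). The boundary seam algebra is $B_{n,k}=P_k\,\mathrm{TL}_N(\beta)\,P_k$,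 with unit $P_k$. *Cellular modules.* Let $d$ be an integer with $0\le d\le n+k$, $d\equiv n+k \pmod 2$ and $n+d\ge k$. $\mathrm{TL}_N(\beta)$ acts on the space of linear combinations of monic $(N,d)$-diagrams by composition, non-monic results being set to $0$. Let $\mathfrak B_{n,k}^d$ be the set of non-zero elements $P_kw$ with $w$ a monic $(N,d)$-diagram; its linear span is the cellular module $S_{n,k}^d$ over $B_{n,k}$. The bilinear form $\langle P_kv,P_kw\rangle$ is the coefficient of the identity $(d,d)$-diagram in $(P_kv)^*(P_kw)$, and its radical is $\{x\in S_{n,k}^d\mid \langle x,y\rangle=0\text{ for all }y\in S_{n,k}^d\}$. **Proposition.** Under these conditions: 1. $S_{n,k}^d$ is cyclic: there is $z\in S_{n,k}^d$ with $B_{n,k}z=S_{n,k}^d$. 2. If the form on $S_{n,k}^d$ is not identically zero, then every element of $S_{n,k}^d$ outside the radical generates $S_{n,k}^d$. 3. Suppose that the form is identically zero, and put $m=(n+k-d)/2$. Let $z$ be the monic $(N,d)$-diagram with $m$ nested arcs that join, if $m\le k$, the first (topmost) $m$ boundary points to the last (lowest) $m$ bulk points and, if $m>k$, the bottom $2m$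 left points among themselves, the remaining left points being joined to the $d$ right points. Then $P_kz\in\mathfrak B_{n,k}^d$, and $P_kz$ generates $S_{n,k}^d$. Moreover, for every monic $(N,d)$-diagram $v$ with $P_kv\ne 0$ there is a single $(N,N)$-diagram $D$ that joins each left boundary point to the right boundary point facing it, such that the concatenation of $D$ with $z$ closes no loop and gives $v$; and the element $a_v=P_kDP_k\in B_{n,k}$ satisfies $a_v(P_kz)=P_kv$. -/

import Mathlib

noncomputable section

namespace Seam

/-! ### Diagrams

The rectangle has `n` marked points on its left side and `m` on its right side; on both sides the
points are numbered `0, 1, …` from top to bottom. The point `i` on the left is `Sum.inl i`, the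
point `j` on the right is `Sum.inr j`. -/

/-- The marked points of an `(n, m)`-diagram. -/
abbrev Point (n m : ℕ) := Fin n ⊕ Fin m

/-- The position of a marked point when one goes along the boundary of the rectangle, down the left
side and then up the right side. -/
def pos {n m : ℕ} : Point n m → ℕ
  | Sum.inl i => i
  | Sum.inr j => n + m - 1 - j

/-- `f` sends every marked point to the other end of its link: the links join the points pairwise
and do not cross. -/
def IsPlanarMatching {n m : ℕ} (f : Point n m → Point n m) : Prop :=
  (∀ x, f (f x) = x) ∧ (∀ x, f x ≠ x) ∧
    ∀ x y, ¬ (pos x < pos y ∧ pos y < pos (f x) ∧ pos (f x) < pos (f y))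

/-- `(n, m)`-diagrams up to isotopy: non-crossing perfect matchings of the marked points. -/
abbrev Diagram (n m : ℕ) := {f : Point n m → Point n m // IsPlanarMatching f}

/-- The identity diagram `Id`: every point is joined to the one facing it. -/
def idDiagram (n : ℕ) : Diagram n n :=
  ⟨Sum.swap, by
    refine ⟨by simp, by rintro (x | x) <;> simp, ?_⟩
    rintro (⟨x, hx⟩ | ⟨x, hx⟩) (⟨y, hy⟩ | ⟨y, hy⟩) <;>
      simp only [pos, Sum.swap_inl, Sum.swap_inr] <;> omega⟩

/-- The links of the diagram that joins `i` to `i + 1` on the left and on the right, and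
every other point to the one facing it (points are counted from `0` here). -/
def genFun (N i : ℕ) (h : i + 1 < N) : Point N N → Point N N
  | Sum.inl x =>
      if x.val = i then Sum.inl ⟨i + 1, h⟩
      else if x.val = i + 1 then Sum.inl ⟨i, by omega⟩ else Sum.inr x
  | Sum.inr x =>
      if x.val = i then Sum.inr ⟨i + 1, h⟩
      else if x.val = i + 1 then Sum.inr ⟨i, by omega⟩ else Sum.inl x

theorem genFun_isPlanarMatching (N i : ℕ) (h : i + 1 < N) :
    IsPlanarMatching (genFun N i h) := by
  refine ⟨?_, ?_, ?_⟩
  · rintro (⟨x, hx⟩ | ⟨x, hx⟩) <;> by_cases h1 : x = i <;> by_cases h2 : x = i + 1 <;>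
      simp [genFun, h1, h2]
  · rintro (⟨x, hx⟩ | ⟨x, hx⟩) <;> by_cases h1 : x = i <;> by_cases h2 : x = i + 1 <;>
      simp [genFun, h1, h2]
  · rintro (⟨x, hx⟩ | ⟨x, hx⟩) (⟨y, hy⟩ | ⟨y, hy⟩) <;>
      by_cases h1 : x = i <;> by_cases h2 : x = i + 1 <;>
      by_cases h3 : y = i <;> by_cases h4 : y = i + 1 <;>
      simp only [genFun, pos, h1, h2, h3, h4, if_true, if_false] <;>
      (try simp only [Nat.succ_ne_self, if_false]) <;> omega

/-- The mirror image `D*` of a diagram `D` (reflection through a vertical mirror). -/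
def mirror {n m : ℕ} (D : Diagram n m) : Diagram m n :=
  ⟨fun x => (D.1 x.swap).swap, by
    have hpos : ∀ x : Point n m, pos x.swap + pos x + 1 = n + m := by
      rintro (⟨x, hx⟩ | ⟨x, hx⟩) <;> simp only [pos, Sum.swap_inl, Sum.swap_inr] <;> omega
    obtain ⟨h1, h2, h3⟩ := D.2
    refine ⟨fun x => by simp [h1], fun x hx => h2 x.swap ?_, fun x y => ?_⟩
    · simpa using congrArg Sum.swap hx
    · intro hxy
      dsimp only at hxy
      have e1 := hpos x.swap
      have e2 := hpos y.swap
      rw [Sum.swap_swap] at e1 e2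
      have e3 := hpos (D.1 x.swap)
      have e4 := hpos (D.1 y.swap)
      refine h3 (D.1 y.swap) (D.1 x.swap) ?_
      rw [h1, h1]
      omega⟩

/-- Two diagrams drawn side by side, the right points of the first being identified with the left
points of the second: the vertices are the left, middle and right points, and two of them are
adjacent when a link of one of the two diagrams joins them. -/
def glued {n m p : ℕ} (D : Diagram n m) (D' : Diagram m p) :
    SimpleGraph (Fin n ⊕ (Fin m ⊕ Fin p)) :=
  SimpleGraph.fromRel fun u v =>
    (∃ x, u = Sum.map id Sum.inl x ∧ v = Sum.map id Sum.inl (D.1 x)) ∨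
    (∃ y, u = Sum.inr y ∧ v = Sum.inr (D'.1 y))

/-- The number of closed loops created by the concatenation: the connected components all of
whose vertices are middle points. -/
def loops {n m p : ℕ} (D : Diagram n m) (D' : Diagram m p) : ℕ :=
  Nat.card {c : (glued D D').ConnectedComponent // ∀ v ∈ c.supp, ∃ j, v = Sum.inr (Sum.inl j)}

/-- `D''` is the diagram obtained by concatenation of `D` and `D'` and removal of the closed
loops: it joins two distinct outer points when a curve of the concatenation joins them. -/
def IsConcat {n m p : ℕ} (D : Diagram n m) (D' : Diagram m p) (D'' : Diagram n p) : Prop :=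
  ∀ x y : Point n p, D''.1 x = y ↔
    x ≠ y ∧ (glued D D').Reachable (Sum.map id Sum.inr x) (Sum.map id Sum.inr y)

/-! ### Temperley-Lieb algebras -/

/-- Formal complex linear combinations of `(n, m)`-diagrams. -/
abbrev Hom (n m : ℕ) := Diagram n m →₀ ℂ

open Classical in
/-- The composition of two diagrams: the concatenation (there is exactly one `D''` with
`IsConcat D D' D''`), with a factor `β` for each closed loop. -/
def compDiagram (β : ℂ) {n m p : ℕ} (D : Diagram n m) (D' : Diagram m p) : Hom n p :=
  ∑ D'' : Diagram n p, if IsConcat D D' D'' then Finsupp.single D'' (β ^ loops D D') else 0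

/-- The bilinear extension of the composition of diagrams. For `n = m = p` it is the product of the
Temperley-Lieb algebra. -/
def comp (β : ℂ) {n m p : ℕ} : Hom n m →ₗ[ℂ] Hom m p →ₗ[ℂ] Hom n p :=
  Finsupp.linearCombination ℂ fun D =>
    Finsupp.linearCombination ℂ fun D' => compDiagram β D D'

/-- The underlying space of the Temperley-Lieb algebra on `N` points. -/
abbrev TL (N : ℕ) := Hom N N

/-- The generator `E_i` of the Temperley-Lieb algebra, `1 ≤ i < N`, which links the `i`-th and the
`(i+1)`-st point from the top on both sides (here points are counted from `1`). -/
def E (N i : ℕ) : TL N :=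
  if h : 1 ≤ i ∧ i < N then
    Finsupp.single ⟨genFun N (i - 1) (by omega), genFun_isPlanarMatching N (i - 1) (by omega)⟩ 1
  else 0

/-- The `q`-number `[m] = (q^m - q^{-m}) / (q - q^{-1})`. -/
def qnum (q : ℂ) (m : ℕ) : ℂ := (q ^ m - (q ^ m)⁻¹) / (q - q⁻¹)

/-- The Wenzl-Jones projectors `P_j` in the Temperley-Lieb algebra on `N` points with
`β = q + q⁻¹`, acting on the bottom `j` points:
`P_1 = Id` and `P_j = P_{j-1} - [j-1]/[j] P_{j-1} E_{N-j+1} P_{j-1}`. -/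
def wenzlJones (q : ℂ) (N : ℕ) : ℕ → TL N
  | 0 => Finsupp.single (idDiagram N) 1
  | 1 => Finsupp.single (idDiagram N) 1
  | (j + 2) =>
      wenzlJones q N (j + 1) - (qnum q (j + 1) / qnum q (j + 2)) •
        comp (q + q⁻¹) (comp (q + q⁻¹) (wenzlJones q N (j + 1)) (E N (N - (j + 2) + 1)))
          (wenzlJones q N (j + 1))

/-! ### Cellular modules of the Temperley-Lieb algebra -/

/-- An `(N, d)`-diagram is monic when it has `d` links crossing from left to right, that is, when
all its right points are joined to left points. -/
def IsMonic {N d : ℕ} (D : Diagram N d) : Prop :=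
  ∀ j : Fin d, ∃ i : Fin N, D.1 (Sum.inr j) = Sum.inl i

/-- Monic `(N, d)`-diagrams. -/
abbrev Monic (N d : ℕ) := {D : Diagram N d // IsMonic D}

/-- The cellular module of the Temperley-Lieb algebra on `N` points: linear combinations of monic
`(N, d)`-diagrams. -/
abbrev Cell (N d : ℕ) := Monic N d →₀ ℂ

/-- A combination of monic diagrams seen as a combination of diagrams. -/
def incl (N d : ℕ) : Cell N d →ₗ[ℂ] Hom N d := Finsupp.lmapDomain ℂ ℂ Subtype.val

/-- The monic part of a combination of diagrams: the other diagrams are set to zero. -/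
def monicPart (N d : ℕ) : Hom N d →ₗ[ℂ] Cell N d :=
  Finsupp.lcomapDomain Subtype.val Subtype.val_injective

/-- The action of the Temperley-Lieb algebra on its cellular module: composition of diagrams, a
result that is not monic being set to zero. -/
def act (β : ℂ) {N d : ℕ} (a : TL N) (v : Cell N d) : Cell N d :=
  monicPart N d (comp β a (incl N d v))

/-- `⟨x, y⟩` is the coefficient of the identity (the monic `(d, d)`-diagram) in `x* y`. -/
def form (β : ℂ) {N d : ℕ} (x y : Cell N d) : ℂ :=
  comp β (Finsupp.lmapDomain ℂ ℂ mirror (incl N d x)) (incl N d y) (idDiagram d)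

/-! ### Boundary seam algebras -/

/-- The projector `P_k` of the Temperley-Lieb algebra on `n + k` points. -/
def seamProj (q : ℂ) (n k : ℕ) : TL (n + k) := wenzlJones q (n + k) k

/-- The element `P_k a P_k`. -/
def sandwich (q : ℂ) (n k : ℕ) (a : TL (n + k)) : TL (n + k) :=
  comp (q + q⁻¹) (comp (q + q⁻¹) (seamProj q n k) a) (seamProj q n k)

/-- The boundary seam algebra `P_k TL_{n+k} P_k`, whose product is that of the
Temperley-Lieb algebra and whose unit is `P_k`. -/
def seamAlgebra (q : ℂ) (n k : ℕ) : Set (TL (n + k)) := Set.range (sandwich q n k)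

/-- The index set of the cellular modules of the seam algebra. -/
def seamIndex (n k : ℕ) : Set ℕ := {d | d ≤ n + k ∧ d ≡ n + k [MOD 2] ∧ k ≤ n + d}

/-- The element `P_k w` for a monic `(n + k, d)`-diagram `w`. -/
def seamVec (q : ℂ) (n k : ℕ) {d : ℕ} (w : Monic (n + k) d) : Cell (n + k) d :=
  act (q + q⁻¹) (seamProj q n k) (Finsupp.single w 1)

/-- The non-zero elements among the `P_k w`. -/
def seamBasis (q : ℂ) (n k d : ℕ) : Set (Cell (n + k) d) :=
  {x | x ≠ 0 ∧ ∃ w : Monic (n + k) d, x = seamVec q n k w}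

/-- The cellular module of the seam algebra, spanned by the non-zero `P_k w`. The seam algebra acts
on it by `act`. -/
def seamCell (q : ℂ) (n k d : ℕ) : Submodule ℂ (Cell (n + k) d) :=
  Submodule.span ℂ (seamBasis q n k d)

/-- The bilinear form of the cellular module: `⟨P_k v, P_k w⟩` is the coefficient of the identity
in `(P_k v)* (P_k w)`. -/
def seamForm (q : ℂ) {n k d : ℕ} (x y : seamCell q n k d) : ℂ :=
  form (q + q⁻¹) (x : Cell (n + k) d) (y : Cell (n + k) d)

/-- The radical of the bilinear form. -/
def seamRadical (q : ℂ) (n k d : ℕ) : Set (seamCell q n k d) :=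
  {x | ∀ y : seamCell q n k d, seamForm q x y = 0}

/-- `z` generates the cellular module over the seam algebra: the elements `a z`, with `a` in the
seam algebra, are exactly the elements of the module. -/
def IsGenerator (q : ℂ) {n k d : ℕ} (z : seamCell q n k d) : Prop :=
  {x | ∃ a ∈ seamAlgebra q n k, act (q + q⁻¹) a (z : Cell (n + k) d) = x} =
    (seamCell q n k d : Set (Cell (n + k) d))

/-- The links of `D` contain the arc between the left points `a` and `b`. -/
def HasArc {N d : ℕ} (D : Diagram N d) (a b : Fin N) : Prop := D.1 (Sum.inl a) = Sum.inl b

/-- The monic `(n + k, d)`-diagram whose `m = (n + k - d) / 2` arcs are nested and join the first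
`m` boundary points to the last `m` bulk points if `m ≤ k`, and the bottom `2m` points with
each other if `k < m`; the other left points are joined to the `d` right points. (On each side
the bulk points are the top `n` points and the boundary points are the bottom `k` points.) -/
def IsNested (n k : ℕ) {d : ℕ} (z : Monic (n + k) d) : Prop :=
  ∃ m : ℕ, n + k = d + 2 * m ∧
    (m ≤ k → ∀ i < m, ∀ a b : Fin (n + k),
      a.val + i + 1 = n → b.val = n + i → HasArc z.1 a b) ∧
    (k < m → ∀ i < m, ∀ a b : Fin (n + k),
      a.val = d + i → b.val + i + 1 = n + k → HasArc z.1 a b)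

/-- Every left boundary point of `D` is joined to the right boundary point facing it. -/
def IsStraightOnBoundary (n k : ℕ) (D : Diagram (n + k) (n + k)) : Prop :=
  ∀ i : Fin (n + k), n ≤ i.val → D.1 (Sum.inl i) = Sum.inr i

end Seam

end

open Seam

noncomputable section

namespace Seam

/-! ### Links of diagrams -/

section Links

variable {n m p : ℕ}

/-! Two mechanisms carry the theorem.

Outside the radical: for `x`, `y` in the module, the combination `x y*` acts as the rank one
operator `z ↦ ⟨y, z⟩ x` (`act_comp_mirror`), because the identity is the only monic `(d, d)`-diagram
(`eq_id_of_isMonic`). If `⟨y, z⟩ ≠ 0`, rescaling by `⟨y, z⟩⁻¹` sends `z` to an arbitrary `x`.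
Sandwiching between projectors changes nothing, since `P_k` is idempotent and fixes the module.

Nested diagram: `P_k w ≠ 0` exactly when no arc of `w` joins two boundary points. Such an arc would
enclose a small one, killed by `P_k E_i = 0` (here `β = [2] ≠ 0` is used); conversely `P_k - 1` only
involves diagrams with a boundary arc, so the coefficient of `w` in `P_k w` is `1`. For `v` without
boundary arcs, non-crossing and counting force the lowest through lines of `v` to be those of the
nested diagram `z`. The remaining links of `v` can be copied into a diagram `D` that is straight on
the boundary: the bulk end of each arc of `z` plays the role of its boundary end (`transport`). When
`m > k`, the surplus arcs of `z` are absorbed by shifted arcs of `D`, which join them into one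
zigzag instead of loops (`reach_chain`). Then `D z = v` without loops, and `D` commutes with `P_k`,
so `P_k D P_k` sends `P_k z` to `P_k v`. This makes no use of the form, so it also proves cyclicity.

The algebra underneath rests on three facts: concatenation is planar (`exists_isConcat`), it is
associative with additive loop numbers (`sum_colouring`, a state sum with two colours), and the
Wenzl–Jones recursion gives the expected projectors (`wenzlJones_properties`). -/

theorem Diagram.invol (D : Diagram n m) (x : Point n m) : D.1 (D.1 x) = x := D.2.1 x

theorem Diagram.injective (D : Diagram n m) : Function.Injective D.1 :=
  Function.LeftInverse.injective D.invol

theorem Diagram.ne_self (D : Diagram n m) (x : Point n m) : D.1 x ≠ x := D.2.2.1 x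

theorem Diagram.not_cross (D : Diagram n m) (x y : Point n m) :
    ¬ (pos x < pos y ∧ pos y < pos (D.1 x) ∧ pos (D.1 x) < pos (D.1 y)) := D.2.2.2 x y

theorem Diagram.symm_apply (D : Diagram n m) {x y : Point n m} (h : D.1 x = y) : D.1 y = x := by
  rw [← h, D.invol]

@[simp] theorem pos_inl (i : Fin n) : pos (Sum.inl i : Point n m) = i := rfl

@[simp] theorem pos_inr (j : Fin m) : pos (Sum.inr j : Point n m) = n + m - 1 - j := rfl

theorem pos_injective : Function.Injective (pos : Point n m → ℕ) := by
  rintro (⟨x, hx⟩ | ⟨x, hx⟩) (⟨y, hy⟩ | ⟨y, hy⟩) h <;> simp at h ⊢ <;> omega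

/-- A point lying strictly inside a link has its partner strictly inside. -/
theorem Diagram.pos_mem (D : Diagram n m) {x u : Point n m} (h1 : pos x < pos u)
    (h2 : pos u < pos (D.1 x)) : pos x < pos (D.1 u) ∧ pos (D.1 u) < pos (D.1 x) := by
  have a := D.not_cross x u
  have b := D.not_cross (D.1 u) x
  rw [D.invol] at b
  have c : pos (D.1 u) ≠ pos x := fun h => by
    have := pos_injective h
    rw [← this, D.invol] at h2; omega
  have d : pos (D.1 u) ≠ pos (D.1 x) := fun h => by
    have := congrArg D.1 (pos_injective h)
    rw [D.invol, D.invol] at this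
    rw [this] at h1; omega
  omega

/-- The involution cancels the terms of a sum of ones over `ZMod 2` in pairs. -/
theorem even_card_of_involution {α : Type*} [DecidableEq α] (f : α → α) (hf : ∀ x, f (f x) = x)
    (hne : ∀ x, f x ≠ x) (s : Finset α) (hs : ∀ x ∈ s, f x ∈ s) : Even s.card := by
  have : ∑ _x ∈ s, (1 : ZMod 2) = 0 :=
    Finset.sum_involution (fun x _ => f x) (fun _ _ => by decide) (fun x _ _ => hne x) hs
      (fun x _ => hf x)
  rw [Finset.sum_const, nsmul_one] at this
  exact (ZMod.natCast_eq_zero_iff_even).1 this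

end Links

theorem card_filter_point {k l : ℕ} (P : Point k l → Prop) [DecidablePred P] :
    (Finset.univ.filter P).card = (Finset.univ.filter fun i => P (Sum.inl i)).card +
      (Finset.univ.filter fun i => P (Sum.inr i)).card := by
  simp only [Finset.card_filter, Fintype.sum_sum_type]

/-! ### Gluing -/

section Glue

variable {n m p : ℕ} (D : Diagram n m) (D' : Diagram m p)

/-- The points of the first diagram among the vertices of the glued graph. -/
abbrev leftV (x : Point n m) : Fin n ⊕ (Fin m ⊕ Fin p) := Sum.map id Sum.inl x

/-- The outer points among the vertices of the glued graph. -/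
abbrev outerV (x : Point n p) : Fin n ⊕ (Fin m ⊕ Fin p) := Sum.map id Sum.inr x

theorem leftV_injective : Function.Injective (leftV : Point n m → Fin n ⊕ (Fin m ⊕ Fin p)) :=
  Sum.map_injective.2 ⟨Function.injective_id, Sum.inl_injective⟩

theorem glued_adj_iff {u v} : (glued D D').Adj u v ↔
    (∃ x, u = leftV x ∧ v = leftV (D.1 x)) ∨ (∃ y, u = Sum.inr y ∧ v = Sum.inr (D'.1 y)) := by
  rw [glued, SimpleGraph.fromRel_adj]
  constructor
  · rintro ⟨-, (⟨x, rfl, rfl⟩ | ⟨x, rfl, rfl⟩) | (⟨x, rfl, rfl⟩ | ⟨x, rfl, rfl⟩)⟩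
    · exact Or.inl ⟨x, rfl, rfl⟩
    · exact Or.inr ⟨x, rfl, rfl⟩
    · exact Or.inl ⟨D.1 x, rfl, by rw [D.invol]⟩
    · exact Or.inr ⟨D'.1 x, rfl, by rw [D'.invol]⟩
  · rintro (⟨x, rfl, rfl⟩ | ⟨x, rfl, rfl⟩)
    · exact ⟨fun h => D.ne_self x (leftV_injective h).symm, Or.inl (Or.inl ⟨x, rfl, rfl⟩)⟩
    · exact ⟨fun h => D'.ne_self x (Sum.inr_injective h).symm, Or.inl (Or.inr ⟨x, rfl, rfl⟩)⟩

theorem reach_left (x : Point n m) : (glued D D').Reachable (leftV x) (leftV (D.1 x)) :=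
  SimpleGraph.Adj.reachable ((glued_adj_iff D D').2 (Or.inl ⟨x, rfl, rfl⟩))

theorem reach_right (y : Point m p) : (glued D D').Reachable (Sum.inr y) (Sum.inr (D'.1 y)) :=
  SimpleGraph.Adj.reachable ((glued_adj_iff D D').2 (Or.inr ⟨y, rfl, rfl⟩))

/-- A function constant on the links is constant on the curves. -/
theorem eq_of_reachable {α : Type*} (g : Fin n ⊕ (Fin m ⊕ Fin p) → α)
    (h1 : ∀ x, g (leftV (D.1 x)) = g (leftV x)) (h2 : ∀ y, g (Sum.inr (D'.1 y)) = g (Sum.inr y))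
    {u v} (h : (glued D D').Reachable u v) : g u = g v := by
  obtain ⟨w⟩ := h
  induction w with
  | nil => rfl
  | cons hadj _ ih =>
    rw [← ih]
    rcases (glued_adj_iff D D').1 hadj with ⟨x, rfl, rfl⟩ | ⟨y, rfl, rfl⟩
    · exact (h1 x).symm
    · exact (h2 y).symm

open Classical in
/-- A curve meeting the boundary has exactly two ends. -/
theorem exists_unique_end (x : Point n p) : ∃ y, y ≠ x ∧ ∀ z,
    (glued D D').Reachable (outerV x) (outerV z) ↔ z = x ∨ z = y := by
  set G := glued D D' with hG
  set C := G.connectedComponentMk (outerV x) with hC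
  set a := (Finset.univ.filter fun i : Fin n => Sum.inl i ∈ C.supp).card
  set b := (Finset.univ.filter fun i : Fin m => Sum.inr (Sum.inl i) ∈ C.supp).card
  set c := (Finset.univ.filter fun i : Fin p => Sum.inr (Sum.inr i) ∈ C.supp).card
  have mem_left : ∀ y, leftV y ∈ C.supp → leftV (D.1 y) ∈ C.supp := by
    intro y hy
    rw [SimpleGraph.ConnectedComponent.mem_supp_iff] at hy ⊢
    rw [← hy]
    exact SimpleGraph.ConnectedComponent.sound (reach_left D D' y).symm
  have mem_right : ∀ y, Sum.inr y ∈ C.supp → Sum.inr (D'.1 y) ∈ C.supp := by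
    intro y hy
    rw [SimpleGraph.ConnectedComponent.mem_supp_iff] at hy ⊢
    rw [← hy]
    exact SimpleGraph.ConnectedComponent.sound (reach_right D D' y).symm
  have hab : Even (a + b) := by
    have := even_card_of_involution D.1 D.invol D.ne_self
      (Finset.univ.filter fun y => leftV y ∈ C.supp) (by simpa using mem_left)
    rwa [card_filter_point] at this
  have hbc : Even (b + c) := by
    have := even_card_of_involution D'.1 D'.invol D'.ne_self
      (Finset.univ.filter fun y => Sum.inr y ∈ C.supp) (by simpa using mem_right)
    rwa [card_filter_point] at this
  -- The weight bounds the degree of a vertex: an outer point lies on one link, a middle point on at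
  -- most two.
  set wt : Fin n ⊕ (Fin m ⊕ Fin p) → ℕ := Sum.elim (fun _ => 1) (Sum.elim (fun _ => 2) fun _ => 1)
    with hwt
  have hsum : ∀ w : Fin n ⊕ (Fin m ⊕ Fin p) → ℕ, ∑ u : C.supp, w u =
      (∑ i : Fin n, if Sum.inl i ∈ C.supp then w (Sum.inl i) else 0) +
      ((∑ i : Fin m, if Sum.inr (Sum.inl i) ∈ C.supp then w (Sum.inr (Sum.inl i)) else 0) +
      ∑ i : Fin p, if Sum.inr (Sum.inr i) ∈ C.supp then w (Sum.inr (Sum.inr i)) else 0) := by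
    intro w
    rw [← Finset.sum_subtype (Finset.univ.filter (· ∈ C.supp)) (by simp) w, Finset.sum_filter,
      Fintype.sum_sum_type, Fintype.sum_sum_type]
  have hcardC : Fintype.card C.supp = a + (b + c) := by
    have := hsum fun _ => 1
    simp only [Finset.sum_const, Finset.card_univ, smul_eq_mul, mul_one] at this
    simp only [this, a, b, c, Finset.card_filter]
  have hwtC : ∑ u : C.supp, wt u = a + (b * 2 + c) := by
    rw [hsum]
    simp only [a, b, c, hwt, Finset.card_filter, Finset.sum_mul, Sum.elim_inl, Sum.elim_inr,
      ite_mul, one_mul, zero_mul]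
  have hdeg : ∀ u : C.supp, C.toSimpleGraph.degree u ≤ wt u := by
    intro u
    have hnb : ((C.toSimpleGraph.neighborFinset u).image Subtype.val).card =
        C.toSimpleGraph.degree u :=
      Finset.card_image_of_injective _ Subtype.val_injective
    rw [← hnb]
    have hadj : ∀ v ∈ (C.toSimpleGraph.neighborFinset u).image Subtype.val, G.Adj u v := by
      intro v hv
      obtain ⟨w, hw, rfl⟩ := Finset.mem_image.1 hv
      rw [SimpleGraph.mem_neighborFinset] at hw
      exact hw
    obtain ⟨u, hu⟩ := u
    rcases u with i | i | i
    · refine (Finset.card_le_card (t := {leftV (D.1 (Sum.inl i))}) fun v hv => ?_).trans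
        (by simp [hwt])
      rcases (glued_adj_iff D D').1 (hadj v hv) with ⟨y | y, h1, rfl⟩ | ⟨y, h1, rfl⟩ <;>
        simp at h1
      simp [h1]
    · refine (Finset.card_le_card (t := {leftV (D.1 (Sum.inr i)), Sum.inr (D'.1 (Sum.inl i))})
        fun v hv => ?_).trans (Finset.card_le_two)
      rcases (glued_adj_iff D D').1 (hadj v hv) with ⟨y | y, h1, rfl⟩ | ⟨y | y, h1, rfl⟩ <;>
        simp at h1 <;> simp [h1]
    · refine (Finset.card_le_card (t := {Sum.inr (D'.1 (Sum.inr i))}) fun v hv => ?_).trans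
        (by simp [hwt])
      rcases (glued_adj_iff D D').1 (hadj v hv) with ⟨y | y, h1, rfl⟩ | ⟨y | y, h1, rfl⟩ <;>
        simp at h1
      simp [h1]
  have hconn := C.connected_toSimpleGraph
  have h1 := hconn.card_vert_le_card_edgeSet_add_one
  have h2 : ∑ u : C.supp, C.toSimpleGraph.degree u = 2 * Nat.card C.toSimpleGraph.edgeSet := by
    rw [Nat.card_eq_fintype_card, ← SimpleGraph.edgeFinset_card]
    convert C.toSimpleGraph.sum_degrees_eq_twice_card_edges
    exact Iff.rfl
  have h3 : ∑ u : C.supp, C.toSimpleGraph.degree u ≤ ∑ u : C.supp, wt u :=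
    Finset.sum_le_sum fun u _ => hdeg u
  have h5 : Nat.card C = a + (b + c) := by
    rw [← hcardC, ← Nat.card_eq_fintype_card]; rfl
  have hO : (Finset.univ.filter fun z : Point n p => outerV z ∈ C.supp).card = a + c :=
    card_filter_point _
  set O := Finset.univ.filter fun z : Point n p => outerV z ∈ C.supp
  have hxO : x ∈ O := by simp [O, hC]
  have hpos := Finset.card_pos.2 ⟨x, hxO⟩
  -- A connected graph has at least (vertices - 1) edges, so `2 (a + b + c - 1) ≤ a + 2 b + c`, that
  -- is `a + c ≤ 2`. The two parities make `a + c` even, and it is positive.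
  have hO2 : O.card = 2 := by
    obtain ⟨r, hr⟩ := hab
    obtain ⟨s, hs⟩ := hbc
    omega
  have mem_O : ∀ z, z ∈ O ↔ G.Reachable (outerV x) (outerV z) := by
    intro z
    simp only [O, Finset.mem_filter, Finset.mem_univ, true_and,
      SimpleGraph.ConnectedComponent.mem_supp_iff, hC, SimpleGraph.ConnectedComponent.eq]
    exact SimpleGraph.reachable_comm
  obtain ⟨y, hy⟩ := Finset.card_eq_one.1 (show (O.erase x).card = 1 by
    rw [Finset.card_erase_of_mem hxO, hO2])
  have hOxy : O = insert x {y} := by rw [← hy, Finset.insert_erase hxO]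
  refine ⟨y, fun h => ?_, fun z => ?_⟩
  · have : y ∈ O.erase x := by rw [hy]; simp
    exact Finset.ne_of_mem_erase this h
  · rw [← mem_O, hOxy]; simp

end Glue

/-! ### Planarity of the concatenation, by a parity argument. -/

section Planarity

variable {n m p : ℕ}

open Classical in
/-- The number of points satisfying `T` on the same side as `x` and above `x`. -/
def countAbove (T : Point n m → Prop) : Point n m → ℕ
  | Sum.inl i => (Finset.univ.filter fun i' : Fin n => T (Sum.inl i') ∧ i' < i).card
  | Sum.inr j => (Finset.univ.filter fun j' : Fin m => T (Sum.inr j') ∧ j' < j).card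

open Classical in
-- The two counts differ by the number of points of `T` strictly inside the link of `x`. By
-- non-crossing, these points are paired among themselves.
theorem countBefore_parity (D : Diagram n m) (T : Point n m → Prop)
    (hT : ∀ x, T x → T (D.1 x)) {x : Point n m} (hx : ¬ T x) :
    (Finset.univ.filter fun u => T u ∧ pos u < pos (D.1 x)).card ≡
      (Finset.univ.filter fun u => T u ∧ pos u < pos x).card [MOD 2] := by
  wlog h : pos x < pos (D.1 x) generalizing x
  · have hne : pos x ≠ pos (D.1 x) := fun h => D.ne_self x (pos_injective h.symm)
    have := @this (D.1 x) (fun h => hx (by simpa [D.invol] using hT _ h))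
      (by rw [D.invol]; omega)
    rw [D.invol] at this
    exact this.symm
  have hev : Even (Finset.univ.filter fun u => T u ∧ pos x < pos u ∧ pos u < pos (D.1 x)).card := by
    refine even_card_of_involution D.1 D.invol D.ne_self _ fun u hu => ?_
    simp only [Finset.mem_filter, Finset.mem_univ, true_and] at hu ⊢
    exact ⟨hT _ hu.1, D.pos_mem hu.2.1 hu.2.2⟩
  have hun : (Finset.univ.filter fun u => T u ∧ pos u < pos (D.1 x)) =
      (Finset.univ.filter fun u => T u ∧ pos u < pos x) ∪
      (Finset.univ.filter fun u => T u ∧ pos x < pos u ∧ pos u < pos (D.1 x)) := by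
    ext u
    simp only [Finset.mem_filter, Finset.mem_univ, true_and, Finset.mem_union]
    constructor
    · rintro ⟨h1, h2⟩
      rcases lt_trichotomy (pos u) (pos x) with h3 | h3 | h3
      · exact Or.inl ⟨h1, h3⟩
      · exact absurd (pos_injective h3 ▸ h1) hx
      · exact Or.inr ⟨h1, h3, h2⟩
    · rintro (⟨h1, h2⟩ | ⟨h1, h2, h3⟩)
      · exact ⟨h1, by omega⟩
      · exact ⟨h1, h3⟩
  rw [hun, Finset.card_union_of_disjoint]
  · obtain ⟨r, hr⟩ := hev
    rw [hr, Nat.ModEq]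
    omega
  · rw [Finset.disjoint_filter]
    rintro u - ⟨-, h1⟩ ⟨-, h2, -⟩
    omega

open Classical in
-- On the left side, above means earlier along the perimeter. On the right side it means later, and
-- the evenness of `T` makes the complementary count have the same parity.
theorem countAbove_modEq (T : Point n m → Prop) (hT : Even (Finset.univ.filter T).card)
    {x : Point n m} (hx : ¬ T x) :
    countAbove T x ≡ (Finset.univ.filter fun u => T u ∧ pos u < pos x).card [MOD 2] := by
  rcases x with i | j
  · rw [card_filter_point]
    have : (Finset.univ.filter fun j : Fin m => T (Sum.inr j) ∧
        pos (Sum.inr j : Point n m) < pos (Sum.inl i : Point n m)) = ∅ := by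
      rw [Finset.filter_eq_empty_iff]
      rintro j - ⟨-, h⟩
      simp only [pos_inl, pos_inr] at h
      omega
    rw [this, Finset.card_empty, add_zero]
    rfl
  · have h1 : countAbove T (Sum.inr j) = (Finset.univ.filter fun u : Point n m =>
        T u ∧ pos (Sum.inr j : Point n m) < pos u).card := by
      rw [card_filter_point]
      have : (Finset.univ.filter fun i : Fin n => T (Sum.inl i) ∧
          pos (Sum.inr j : Point n m) < pos (Sum.inl i : Point n m)) = ∅ := by
        rw [Finset.filter_eq_empty_iff]
        rintro i - ⟨-, h⟩
        simp only [pos_inl, pos_inr] at h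
        omega
      rw [this, Finset.card_empty, zero_add, countAbove]
      congr 1
      ext j'
      rw [Finset.mem_filter, Finset.mem_filter]
      simp only [Finset.mem_univ, true_and, pos_inr, Fin.lt_def]
      refine and_congr_right fun _ => ?_
      omega
    have h2 : (Finset.univ.filter T).card =
        (Finset.univ.filter fun u => T u ∧ pos u < pos (Sum.inr j : Point n m)).card +
        (Finset.univ.filter fun u => T u ∧ pos (Sum.inr j : Point n m) < pos u).card := by
      rw [← Finset.card_union_of_disjoint]
      · congr 1
        ext u
        simp only [Finset.mem_filter, Finset.mem_univ, true_and, Finset.mem_union]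
        constructor
        · intro h
          rcases lt_trichotomy (pos u) (pos (Sum.inr j : Point n m)) with h3 | h3 | h3
          · exact Or.inl ⟨h, h3⟩
          · exact absurd (pos_injective h3 ▸ h) hx
          · exact Or.inr ⟨h, h3⟩
        · rintro (h | h) <;> exact h.1
      · rw [Finset.disjoint_filter]
        rintro u - ⟨-, h1⟩ ⟨-, h2⟩
        omega
    obtain ⟨r, hr⟩ := hT
    rw [h1, Nat.ModEq]
    omega

open Classical in
/-- Along a link outside of a union `T` of links, the number of points of `T` above has constant
parity. -/
theorem countAbove_link (D : Diagram n m) (T : Point n m → Prop)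
    (hT : ∀ x, T x → T (D.1 x)) {x : Point n m} (hx : ¬ T x) :
    countAbove T (D.1 x) ≡ countAbove T x [MOD 2] := by
  have hev := even_card_of_involution D.1 D.invol D.ne_self (Finset.univ.filter T)
    (by simpa using hT)
  have hx' : ¬ T (D.1 x) := fun h => hx (by simpa [D.invol] using hT _ h)
  exact ((countAbove_modEq T hev hx').trans (countBefore_parity D T hT hx)).trans
    (countAbove_modEq T hev hx).symm

open Classical in
-- Counting above, rather than before, is what glues: a middle point has the same count as a right
-- point of `D` and as a left point of `D'`, so the parity passes from one diagram to the other
-- along a curve.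
theorem countAbove_curve (D : Diagram n m) (D' : Diagram m p)
    (T : Fin n ⊕ (Fin m ⊕ Fin p) → Prop)
    (h1 : ∀ x, T (leftV x) → T (leftV (D.1 x))) (h2 : ∀ y, T (Sum.inr y) → T (Sum.inr (D'.1 y)))
    {y z : Point n p} (hy : ¬ T (outerV y)) (hyz : (glued D D').Reachable (outerV y) (outerV z)) :
    countAbove (fun x => T (outerV x)) z ≡ countAbove (fun x => T (outerV x)) y [MOD 2] := by
  -- The value `2`, which is not a parity, makes `g` constant on the links inside `T` too.
  set g : Fin n ⊕ (Fin m ⊕ Fin p) → ℕ := fun u => if T u then 2 else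
    (Sum.elim (fun i => countAbove (fun x : Point n p => T (outerV x)) (Sum.inl i))
      (Sum.elim (fun i => countAbove (fun x : Point m p => T (Sum.inr x)) (Sum.inl i))
        fun i => countAbove (fun x : Point n p => T (outerV x)) (Sum.inr i)) u) % 2 with hg
  have e1 : ∀ x, T (leftV (D.1 x)) ↔ T (leftV x) := fun x =>
    ⟨fun h => by simpa [D.invol] using h1 _ h, h1 x⟩
  have e2 : ∀ x, T (Sum.inr (D'.1 x)) ↔ T (Sum.inr x) := fun x =>
    ⟨fun h => by simpa [D'.invol] using h2 _ h, h2 x⟩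
  have gl : ∀ x, ¬ T (leftV x) → g (leftV x) = countAbove (fun x => T (leftV x)) x % 2 := by
    rintro (x | x) hx
    · simp only [hg, if_neg hx]; rfl
    · simp only [hg, if_neg hx]; rfl
  have gr : ∀ x, ¬ T (Sum.inr x) → g (Sum.inr x) = countAbove (fun x => T (Sum.inr x)) x % 2 := by
    rintro (x | x) hx
    · simp only [hg, if_neg hx]; rfl
    · simp only [hg, if_neg hx]; rfl
  have go : ∀ x, ¬ T (outerV x) → g (outerV x) = countAbove (fun x => T (outerV x)) x % 2 := by
    rintro (x | x) hx
    · simp only [hg, if_neg hx]; rfl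
    · simp only [hg, if_neg hx]; rfl
  have key := eq_of_reachable D D' g (fun x => ?_) (fun x => ?_) hyz
  · have hz : ¬ T (outerV z) := fun h => hy
      ((eq_of_reachable D D' T (fun x => propext (e1 x)) (fun x => propext (e2 x)) hyz) ▸ h)
    rw [go y hy, go z hz] at key
    exact key.symm
  · by_cases hx : T (leftV x)
    · simp only [hg, if_pos hx, if_pos ((e1 x).2 hx)]
    · rw [gl x hx, gl _ (fun h => hx ((e1 x).1 h))]
      exact countAbove_link D (fun x => T (leftV x)) h1 hx
  · by_cases hx : T (Sum.inr x)
    · simp only [hg, if_pos hx, if_pos ((e2 x).2 hx)]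
    · rw [gr x hx, gr _ (fun h => hx ((e2 x).1 h))]
      exact countAbove_link D' (fun x => T (Sum.inr x)) h2 hx

open Classical in
-- If the links of `x` and `y` crossed, let `T` be the curve through `x`. The parity of `T` above is
-- the same at both ends of the curve of `y`, yet one end of `T` precedes `y` and two precede the
-- partner of `y`.
theorem exists_isConcat (D : Diagram n m) (D' : Diagram m p) : ∃ D'', IsConcat D D' D'' := by
  choose f hf1 hf2 using exists_unique_end D D'
  have hreach : ∀ x, (glued D D').Reachable (outerV x) (outerV (f x)) :=
    fun x => (hf2 x _).2 (Or.inr rfl)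
  have hinv : ∀ x, f (f x) = x := fun x =>
    (((hf2 (f x) x).1 (hreach x).symm).resolve_left fun h => hf1 x h.symm).symm
  refine ⟨⟨f, hinv, hf1, ?_⟩, fun x y => ?_⟩
  · rintro x y ⟨h1, h2, h3⟩
    obtain ⟨T, hT⟩ : ∃ T : Fin n ⊕ (Fin m ⊕ Fin p) → Prop,
        ∀ u, T u ↔ (glued D D').Reachable (outerV x) u := ⟨_, fun _ => Iff.rfl⟩
    have hTo : ∀ z, T (outerV z) ↔ z = x ∨ z = f x := fun z => (hT _).trans (hf2 x z)
    have hy : ¬ T (outerV y) := by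
      rw [hTo]; rintro (rfl | rfl) <;> omega
    have hfy : ¬ T (outerV (f y)) := by
      rw [hTo]; rintro (h | h) <;> rw [h] at h3 <;> omega
    have key := countAbove_curve D D' T
      (fun u hu => (hT _).2 (((hT _).1 hu).trans (reach_left D D' u)))
      (fun u hu => (hT _).2 (((hT _).1 hu).trans (reach_right D D' u))) hy (hreach y)
    have hset : Finset.univ.filter (fun z => T (outerV z)) = {x, f x} := by
      ext z; simp [hTo]
    have hev : Even (Finset.univ.filter fun z => T (outerV z)).card := by
      rw [hset, Finset.card_pair (hf1 x).symm]; decide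
    have k1 := countAbove_modEq (fun z => T (outerV z)) hev hy
    have k2 := countAbove_modEq (fun z => T (outerV z)) hev hfy
    have c1 : (Finset.univ.filter fun u => T (outerV u) ∧ pos u < pos y) = {x} := by
      ext u
      simp only [hTo, Finset.mem_filter, Finset.mem_univ, true_and, Finset.mem_singleton]
      constructor
      · rintro ⟨rfl | rfl, h⟩
        · rfl
        · omega
      · rintro rfl; exact ⟨Or.inl rfl, h1⟩
    have c2 : (Finset.univ.filter fun u => T (outerV u) ∧ pos u < pos (f y)) = {x, f x} := by
      ext u
      simp only [hTo, Finset.mem_filter, Finset.mem_univ, true_and, Finset.mem_insert,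
        Finset.mem_singleton]
      constructor
      · exact fun h => h.1
      · rintro (rfl | rfl)
        · exact ⟨Or.inl rfl, by omega⟩
        · exact ⟨Or.inr rfl, by omega⟩
    rw [c1, Finset.card_singleton] at k1
    rw [c2, Finset.card_pair (hf1 x).symm] at k2
    have := (k2.symm.trans key).trans k1
    exact absurd this (by decide)
  · change f x = y ↔ x ≠ y ∧ (glued D D').Reachable (outerV x) (outerV y)
    rw [hf2]
    constructor
    · rintro rfl; exact ⟨(hf1 x).symm, Or.inr rfl⟩
    · rintro ⟨h1, h2⟩; exact (h2.resolve_left (Ne.symm h1)).symm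

/-- The diagram obtained by concatenation. -/
def concat (D : Diagram n m) (D' : Diagram m p) : Diagram n p := (exists_isConcat D D').choose

theorem isConcat_concat (D : Diagram n m) (D' : Diagram m p) : IsConcat D D' (concat D D') :=
  (exists_isConcat D D').choose_spec

theorem IsConcat.eq_concat {D : Diagram n m} {D' : Diagram m p} {D'' : Diagram n p}
    (h : IsConcat D D' D'') : D'' = concat D D' :=
  Subtype.ext <| funext fun x => (h x _).2 ((isConcat_concat D D' x _).1 rfl)

theorem concat_reachable (D : Diagram n m) (D' : Diagram m p) (x : Point n p) :
    (glued D D').Reachable (outerV x) (outerV ((concat D D').1 x)) :=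
  ((isConcat_concat D D' x _).1 rfl).2

theorem concat_apply {D : Diagram n m} {D' : Diagram m p} {x y : Point n p} (hxy : x ≠ y)
    (h : (glued D D').Reachable (outerV x) (outerV y)) : (concat D D').1 x = y :=
  (isConcat_concat D D' x y).2 ⟨hxy, h⟩

theorem compDiagram_eq (β : ℂ) (D : Diagram n m) (D' : Diagram m p) :
    compDiagram β D D' = Finsupp.single (concat D D') (β ^ loops D D') := by
  classical
  rw [compDiagram, Finset.sum_eq_single (concat D D'), if_pos (isConcat_concat D D')]
  · intro D'' _ h
    rw [if_neg fun h' => h h'.eq_concat]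
  · intro h; exact absurd (Finset.mem_univ _) h

end Planarity

/-! ### Two-colour state sums, which detect both the concatenation and its loops. -/

section Colourings

variable {n m p r : ℕ}

open Classical in
/-- The indicator function of the colourings of the points that are constant on the links. -/
def colouring (D : Diagram n m) (a : Fin n → Bool) (b : Fin m → Bool) : ℕ :=
  if ∀ x, Sum.elim a b (D.1 x) = Sum.elim a b x then 1 else 0

theorem colouring_true (D : Diagram n m) : colouring D (fun _ => true) (fun _ => true) = 1 :=
  if_pos (by rintro x; rcases D.1 x with y | y <;> rcases x with x | x <;> rfl)

/-- The colouring that distinguishes a single link of `D` is admissible for `D'` only if `D'` has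
that link. -/
theorem eq_of_colouring {D D' : Diagram n m} (h : ∀ a b, colouring D a b = colouring D' a b) :
    D = D' := by
  classical
  refine Subtype.ext (funext fun x => ?_)
  let col : Point n m → Bool := fun y => decide (y = x ∨ y = D.1 x)
  have hcol : Sum.elim (fun i => col (Sum.inl i)) (fun j => col (Sum.inr j)) = col := by
    funext y; rcases y with y | y <;> rfl
  have h1 : colouring D (fun i => col (Sum.inl i)) (fun j => col (Sum.inr j)) = 1 := by
    rw [colouring, if_pos]
    intro y
    rw [hcol]
    refine decide_eq_decide.2 ⟨?_, ?_⟩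
    · rintro (h | h)
      · exact Or.inr (by rw [← h, D.invol])
      · exact Or.inl (by rw [← D.invol y, h, D.invol])
    · rintro (h | h)
      · exact Or.inr (by rw [h])
      · exact Or.inl (by rw [h, D.invol])
  rw [h, colouring] at h1
  split_ifs at h1 with h2
  have h3 := h2 x
  rw [hcol] at h3
  exact (((decide_eq_decide.1 h3).2 (Or.inl rfl)).resolve_left (D'.ne_self x)).symm

open Classical in
-- Admissible colourings are those constant on curves. Curves that meet the boundary take their
-- colour from `a` and `c`, while each loop has a free choice of two. Concatenation thus becomes a
-- matrix product with loop weight `2`.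
theorem sum_colouring (D : Diagram n m) (D' : Diagram m p) (a : Fin n → Bool) (c : Fin p → Bool) :
    ∑ b, colouring D a b * colouring D' b c =
      2 ^ loops D D' * colouring (concat D D') a c := by
  set G := glued D D' with hG
  set P : (Fin m → Bool) → Prop := fun b => (∀ x, Sum.elim a b (D.1 x) = Sum.elim a b x) ∧
    ∀ x, Sum.elim b c (D'.1 x) = Sum.elim b c x with hP
  set col : (Fin m → Bool) → Fin n ⊕ (Fin m ⊕ Fin p) → Bool := fun b => Sum.elim a (Sum.elim b c)
  have col_left : ∀ b x, col b (leftV x) = Sum.elim a b x := by rintro b (x | x) <;> rfl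
  have col_outer : ∀ b x, col b (outerV x) = Sum.elim a c x := by rintro b (x | x) <;> rfl
  have col_reach : ∀ b, P b → ∀ u v, G.Reachable u v → col b u = col b v := by
    intro b hb u v huv
    refine eq_of_reachable D D' (col b) (fun x => ?_) (fun y => ?_) huv
    · rw [col_left, col_left, hb.1]
    · exact hb.2 y
  have hsum : ∑ b, colouring D a b * colouring D' b c = Nat.card {b // P b} := by
    rw [Nat.card_eq_fintype_card, Fintype.card_subtype, Finset.card_filter]
    refine Finset.sum_congr rfl fun b _ => ?_
    simp only [colouring, hP, ite_and]
    split_ifs <;> rfl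
  rw [hsum, colouring]
  split_ifs with hc
  · set IsLoop : G.ConnectedComponent → Prop := fun C => ∀ v ∈ C.supp, ∃ j, v = Sum.inr (Sum.inl j)
      with hloop
    have not_loop : ∀ x : Point n p, ¬ IsLoop (G.connectedComponentMk (outerV x)) := by
      intro x hx
      obtain ⟨j, hj⟩ := hx (outerV x) rfl
      rcases x with x | x <;> simp at hj
    have ex_outer : ∀ C : G.ConnectedComponent, ¬ IsLoop C →
        ∃ x : Point n p, C = G.connectedComponentMk (outerV x) := by
      intro C hC
      simp only [hloop, not_forall] at hC
      obtain ⟨v, hv, h⟩ := hC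
      rcases v with i | j | i
      · exact ⟨Sum.inl i, hv.symm⟩
      · exact absurd ⟨j, rfl⟩ h
      · exact ⟨Sum.inr i, hv.symm⟩
    -- An admissible colouring of the middle points is recorded by the colours of the loops, read at
    -- one representative of each.
    let Φ : {b // P b} → ({C // IsLoop C} → Bool) := fun b C => col b.1 C.1.out
    have hΦ : Function.Bijective Φ := by
      constructor
      · intro b b' h
        refine Subtype.ext (funext fun j => ?_)
        by_cases hl : IsLoop (G.connectedComponentMk (Sum.inr (Sum.inl j)))
        · have h1 := congrFun h ⟨_, hl⟩
          have h2 : G.Reachable (G.connectedComponentMk (Sum.inr (Sum.inl j))).out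
              (Sum.inr (Sum.inl j)) := SimpleGraph.ConnectedComponent.exact (Quot.out_eq _)
          simp only [Φ] at h1
          rw [col_reach _ b.2 _ _ h2, col_reach _ b'.2 _ _ h2] at h1
          exact h1
        · obtain ⟨x, hx⟩ := ex_outer _ hl
          have h2 := SimpleGraph.ConnectedComponent.exact hx
          have e1 := col_reach _ b.2 _ _ h2
          have e2 := col_reach _ b'.2 _ _ h2
          rw [col_outer] at e1 e2
          exact e1.trans e2.symm
      · intro h
        let Gc : G.ConnectedComponent → Bool := fun C =>
          if hl : IsLoop C then h ⟨C, hl⟩ else Sum.elim a c (ex_outer C hl).choose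
        have Gc_outer : ∀ x, Gc (G.connectedComponentMk (outerV x)) = Sum.elim a c x := by
          intro x
          simp only [Gc, dif_neg (not_loop x)]
          have hx := SimpleGraph.ConnectedComponent.exact (ex_outer _ (not_loop x)).choose_spec
          set y := (ex_outer _ (not_loop x)).choose
          by_cases hxy : x = y
          · rw [← hxy]
          · rw [← concat_apply hxy hx, hc]
        let b : Fin m → Bool := fun j => Gc (G.connectedComponentMk (Sum.inr (Sum.inl j)))
        have hcol : ∀ v, col b v = Gc (G.connectedComponentMk v) := by
          rintro (i | j | i)
          · exact (Gc_outer (Sum.inl i)).symm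
          · rfl
          · exact (Gc_outer (Sum.inr i)).symm
        have hb : P b := by
          constructor
          · intro x
            rw [← col_left, ← col_left, hcol, hcol]
            exact congrArg Gc (SimpleGraph.ConnectedComponent.sound (reach_left D D' x)).symm
          · intro x
            change col b (Sum.inr _) = col b (Sum.inr _)
            rw [hcol, hcol]
            exact congrArg Gc (SimpleGraph.ConnectedComponent.sound (reach_right D D' x)).symm
        refine ⟨⟨b, hb⟩, funext fun C => ?_⟩
        change col b C.1.out = h C
        rw [hcol]
        have : G.connectedComponentMk C.1.out = C.1 := Quot.out_eq _
        rw [this]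
        simp only [Gc, dif_pos C.2]
    rw [Nat.card_congr (Equiv.ofBijective Φ hΦ), Nat.card_fun, mul_one, Nat.card_eq_fintype_card,
      Fintype.card_bool]
    rfl
  · rw [mul_zero, Nat.card_eq_zero]
    left
    refine ⟨fun b => hc fun x => ?_⟩
    rw [← col_outer b.1, ← col_outer b.1]
    exact (col_reach _ b.2 _ _ (concat_reachable D D' x)).symm

/-- This is associativity of the product of the `colouring` matrices. The constant colouring
isolates the powers of `2`, hence the loop numbers; cancelling them leaves the diagrams. -/
theorem concat_assoc_loops (D : Diagram n m) (D' : Diagram m p) (D'' : Diagram p r) :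
    concat (concat D D') D'' = concat D (concat D' D'') ∧
      loops D D' + loops (concat D D') D'' = loops D' D'' + loops D (concat D' D'') := by
  have key : ∀ a d, 2 ^ (loops D D' + loops (concat D D') D'') *
      colouring (concat (concat D D') D'') a d =
      2 ^ (loops D' D'' + loops D (concat D' D'')) * colouring (concat D (concat D' D'')) a d := by
    intro a d
    calc _ = ∑ c, (∑ b, colouring D a b * colouring D' b c) * colouring D'' c d := by
          simp only [sum_colouring, mul_assoc, ← Finset.mul_sum, pow_add]
      _ = ∑ b, colouring D a b * ∑ c, colouring D' b c * colouring D'' c d := by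
          simp only [Finset.sum_mul, Finset.mul_sum, mul_assoc]
          exact Finset.sum_comm
      _ = _ := by
          simp only [sum_colouring, pow_add, mul_left_comm _ (2 ^ loops D' D''), ← Finset.mul_sum,
            mul_assoc]
  have hl : loops D D' + loops (concat D D') D'' = loops D' D'' + loops D (concat D' D'') := by
    have := key (fun _ => true) (fun _ => true)
    rw [colouring_true, colouring_true, mul_one, mul_one] at this
    exact Nat.pow_right_injective le_rfl this
  refine ⟨eq_of_colouring fun a d => ?_, hl⟩
  have := key a d
  rw [hl] at this
  exact Nat.eq_of_mul_eq_mul_left (by positivity) this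

end Colourings

/-! ### Associativity and units for linear combinations of diagrams. -/

section Category

variable {n m p r : ℕ}

@[simp] theorem comp_single (β : ℂ) (D : Diagram n m) (D' : Diagram m p) (a b : ℂ) :
    comp β (Finsupp.single D a) (Finsupp.single D' b) =
      Finsupp.single (concat D D') (a * b * β ^ loops D D') := by
  simp only [comp, Finsupp.linearCombination_single, LinearMap.smul_apply, compDiagram_eq,
    Finsupp.smul_single, smul_eq_mul, mul_assoc]

theorem comp_assoc (β : ℂ) (x : Hom n m) (y : Hom m p) (z : Hom p r) :
    comp β (comp β x y) z = comp β x (comp β y z) := by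
  induction x using Finsupp.induction_linear with
  | zero => simp
  | add x x' hx hx' => simp only [map_add, LinearMap.add_apply, hx, hx']
  | single D a =>
    induction y using Finsupp.induction_linear with
    | zero => simp
    | add x x' hx hx' => simp only [map_add, LinearMap.add_apply, hx, hx']
    | single D' b =>
      induction z using Finsupp.induction_linear with
      | zero => simp
      | add x x' hx hx' => simp only [map_add, hx, hx']
      | single D'' c =>
        obtain ⟨h1, h2⟩ := concat_assoc_loops D D' D''
        simp only [comp_single, h1]
        congr 1
        have h3 : β ^ loops D D' * β ^ loops (concat D D') D'' =
          β ^ loops D' D'' * β ^ loops D (concat D' D'') := by rw [← pow_add, ← pow_add, h2]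
        linear_combination a * b * c * h3

/-- If every middle point lies on a curve that meets the boundary, then there is no loop. -/
theorem loops_eq_zero {D : Diagram n m} {D' : Diagram m p}
    (h : ∀ j : Fin m, ∃ x : Point n p, (glued D D').Reachable (Sum.inr (Sum.inl j)) (outerV x)) :
    loops D D' = 0 := by
  rw [loops, Nat.card_eq_zero]
  left
  refine ⟨fun ⟨C, hC⟩ => ?_⟩
  induction C using SimpleGraph.ConnectedComponent.ind with
  | h v =>
    obtain ⟨j, rfl⟩ := hC v rfl
    obtain ⟨x, hx⟩ := h j
    obtain ⟨i, hi⟩ := hC (outerV x) (SimpleGraph.ConnectedComponent.sound hx.symm)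
    rcases x with x | x <;> simp at hi

theorem reach_id_left (D : Diagram n m) (i : Fin n) :
    (glued (idDiagram n) D).Reachable (Sum.inl i) (Sum.inr (Sum.inl i)) :=
  reach_left (idDiagram n) D (Sum.inl i)

theorem reach_id_right (D : Diagram n m) (i : Fin m) :
    (glued D (idDiagram m)).Reachable (Sum.inr (Sum.inl i)) (Sum.inr (Sum.inr i)) :=
  reach_right D (idDiagram m) (Sum.inl i)

@[simp] theorem loops_id_left (D : Diagram n m) : loops (idDiagram n) D = 0 :=
  loops_eq_zero fun j => ⟨Sum.inl j, (reach_id_left D j).symm⟩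

@[simp] theorem loops_id_right (D : Diagram n m) : loops D (idDiagram m) = 0 :=
  loops_eq_zero fun j => ⟨Sum.inr j, reach_id_right D j⟩

@[simp] theorem concat_id_left (D : Diagram n m) : concat (idDiagram n) D = D := by
  refine Subtype.ext (funext fun x => concat_apply (D.ne_self x).symm ?_)
  have h : ∀ y : Point n m, (glued (idDiagram n) D).Reachable (outerV y) (Sum.inr y) := by
    rintro (y | y)
    · exact reach_id_left D y
    · exact SimpleGraph.Reachable.refl _
  exact ((h x).trans (reach_right _ D x)).trans (h _).symm

@[simp] theorem concat_id_right (D : Diagram n m) : concat D (idDiagram m) = D := by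
  refine Subtype.ext (funext fun x => concat_apply (D.ne_self x).symm ?_)
  have h : ∀ y : Point n m, (glued D (idDiagram m)).Reachable (outerV y) (leftV y) := by
    rintro (y | y)
    · exact SimpleGraph.Reachable.refl _
    · exact (reach_id_right D y).symm
  exact ((h x).trans (reach_left D _ x)).trans (h _).symm

/-- The unit of the Temperley-Lieb algebra. -/
abbrev one (n : ℕ) : Hom n n := Finsupp.single (idDiagram n) 1

@[simp] theorem one_comp (β : ℂ) (x : Hom n m) : comp β (one n) x = x := by
  induction x using Finsupp.induction_linear with
  | zero => simp
  | add x x' hx hx' => simp only [map_add, hx, hx']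
  | single D a => simp

@[simp] theorem comp_one (β : ℂ) (x : Hom n m) : comp β x (one m) = x := by
  induction x using Finsupp.induction_linear with
  | zero => simp
  | add x x' hx hx' => simp only [map_add, LinearMap.add_apply, hx, hx']
  | single D a => simp

end Category

/-! ### The mirror image as an anti-involution. -/

section MirrorImage

variable {n m p : ℕ}

theorem colouring_mirror (D : Diagram n m) (a : Fin n → Bool) (b : Fin m → Bool) :
    colouring (mirror D) b a = colouring D a b := by
  have h : ∀ x : Point n m, Sum.elim b a x.swap = Sum.elim a b x := by rintro (x | x) <;> rfl
  rw [colouring, colouring]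
  congr 1
  refine propext ⟨fun H x => ?_, fun H x => ?_⟩
  · have := H x.swap
    simp only [mirror, Sum.swap_swap, h] at this
    exact this
  · have := H x.swap
    simp only [mirror, h]
    rw [this, ← h, Sum.swap_swap]

/-- The mirror image transposes the `colouring` matrix, and transposition reverses products. -/
theorem mirror_concat_loops (D : Diagram n m) (D' : Diagram m p) :
    mirror (concat D D') = concat (mirror D') (mirror D) ∧
      loops D D' = loops (mirror D') (mirror D) := by
  have key : ∀ a c, 2 ^ loops D D' * colouring (mirror (concat D D')) c a =
      2 ^ loops (mirror D') (mirror D) * colouring (concat (mirror D') (mirror D)) c a := by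
    intro a c
    rw [← sum_colouring, colouring_mirror, ← sum_colouring]
    simp only [colouring_mirror, mul_comm]
  have hl : loops D D' = loops (mirror D') (mirror D) := by
    have := key (fun _ => true) (fun _ => true)
    rw [colouring_true, colouring_true, mul_one, mul_one] at this
    exact Nat.pow_right_injective le_rfl this
  refine ⟨eq_of_colouring fun c a => ?_, hl⟩
  have := key a c
  rw [hl] at this
  exact Nat.eq_of_mul_eq_mul_left (by positivity) this

theorem mirror_id : mirror (idDiagram n) = idDiagram n :=
  Subtype.ext (funext fun x => by simp [mirror, idDiagram])

theorem mirror_mirror (D : Diagram n m) : mirror (mirror D) = D :=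
  Subtype.ext (funext fun x => by simp [mirror])

/-- The linear extension of the mirror image. -/
abbrev mirrorHom : Hom n m →ₗ[ℂ] Hom m n := Finsupp.lmapDomain ℂ ℂ mirror

theorem mirrorHom_single (D : Diagram n m) (a : ℂ) :
    mirrorHom (Finsupp.single D a) = Finsupp.single (mirror D) a := by simp

theorem mirrorHom_mirrorHom (x : Hom n m) : mirrorHom (mirrorHom x) = x := by
  induction x using Finsupp.induction_linear with
  | zero => simp
  | add x x' hx hx' => rw [map_add, map_add, hx, hx']
  | single D a => rw [mirrorHom_single, mirrorHom_single, mirror_mirror]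

theorem mirrorHom_comp (β : ℂ) (x : Hom n m) (y : Hom m p) :
    mirrorHom (comp β x y) = comp β (mirrorHom y) (mirrorHom x) := by
  induction x using Finsupp.induction_linear with
  | zero => simp
  | add x x' hx hx' => rw [map_add, map_add, LinearMap.add_apply, map_add, hx, hx', map_add]
  | single D a =>
    induction y using Finsupp.induction_linear with
    | zero => simp
    | add x x' hx hx' => rw [map_add, map_add, hx, hx', map_add, map_add, LinearMap.add_apply]
    | single D' b =>
      obtain ⟨h1, h2⟩ := mirror_concat_loops D D'
      rw [comp_single, mirrorHom_single, mirrorHom_single, mirrorHom_single, comp_single, h1, h2,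
        mul_comm a b]

theorem mirrorHom_apply_id (x : Hom n n) : mirrorHom x (idDiagram n) = x (idDiagram n) := by
  have hinj : Function.Injective (mirror : Diagram n n → Diagram n n) :=
    Function.LeftInverse.injective mirror_mirror
  have := Finsupp.mapDomain_apply hinj x (idDiagram n)
  rw [mirror_id] at this
  exact this

end MirrorImage

/-! ### Cellular modules and rank one operators. -/

section MonicDiagrams

variable {N M d : ℕ}

theorem monicPart_apply (y : Hom N d) (w : Monic N d) : monicPart N d y w = y w.1 := rfl

theorem incl_single (w : Monic N d) (a : ℂ) :
    incl N d (Finsupp.single w a) = Finsupp.single w.1 a := by simp [incl]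

theorem incl_apply (x : Cell N d) (w : Monic N d) : incl N d x w.1 = x w :=
  Finsupp.mapDomain_apply Subtype.val_injective x w

@[simp] theorem monicPart_incl (x : Cell N d) : monicPart N d (incl N d x) = x :=
  Finsupp.ext fun w => by rw [monicPart_apply, incl_apply]

theorem monicPart_single (w : Monic N d) (a : ℂ) :
    monicPart N d (Finsupp.single w.1 a) = Finsupp.single w a := by
  rw [← incl_single, monicPart_incl]

theorem monicPart_single_of_not {D : Diagram N d} (h : ¬ IsMonic D) (a : ℂ) :
    monicPart N d (Finsupp.single D a) = 0 :=
  Finsupp.ext fun w => by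
    rw [monicPart_apply, Finsupp.single_apply, if_neg, Finsupp.zero_apply]
    rintro rfl
    exact h w.2

theorem not_isMonic_iff {D : Diagram N d} :
    ¬ IsMonic D ↔ ∃ j j', D.1 (Sum.inr j) = Sum.inr j' := by
  rw [IsMonic, not_forall]
  refine exists_congr fun j => ?_
  rcases D.1 (Sum.inr j) with i | i <;> simp

theorem not_isMonic_concat (D : Diagram N M) {D' : Diagram M d} (h : ¬ IsMonic D') :
    ¬ IsMonic (concat D D') := by
  rw [not_isMonic_iff] at h ⊢
  obtain ⟨j, j', h⟩ := h
  refine ⟨j, j', concat_apply (fun h' => D'.ne_self (Sum.inr j) ?_) ?_⟩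
  · rw [h, Sum.inr_injective h']
  · have := reach_right D D' (Sum.inr j)
    rwa [h] at this

/-- Non-monic combinations are stable under composition on the left, because an arc between right
points survives. Truncation can therefore be postponed to the end, which makes `act` a module
action. -/
theorem monicPart_comp_incl (β : ℂ) (a : Hom N M) (y : Hom M d) :
    monicPart N d (comp β a (incl M d (monicPart M d y))) = monicPart N d (comp β a y) := by
  induction y using Finsupp.induction_linear with
  | zero => simp
  | add x x' hx hx' => simp only [map_add, hx, hx']
  | single D c =>
    by_cases h : IsMonic D
    · rw [monicPart_single ⟨D, h⟩, incl_single]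
    · rw [monicPart_single_of_not h, map_zero, map_zero, map_zero]
      induction a using Finsupp.induction_linear with
      | zero => simp
      | add x x' hx hx' => rw [map_add, LinearMap.add_apply, map_add, ← hx, ← hx', add_zero]
      | single D' e => rw [comp_single, monicPart_single_of_not (not_isMonic_concat D' h)]

/-- The action as a bilinear map. -/
def actHom (β : ℂ) (N d : ℕ) : TL N →ₗ[ℂ] Cell N d →ₗ[ℂ] Cell N d :=
  ((comp β).compr₂ (monicPart N d)).compl₂ (incl N d)

theorem act_eq (β : ℂ) (a : TL N) (x : Cell N d) : act β a x = actHom β N d a x := rfl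

theorem act_act (β : ℂ) (a b : TL N) (x : Cell N d) :
    act β a (act β b x) = act β (comp β a b) x := by
  rw [act, act, act, monicPart_comp_incl, comp_assoc]

theorem form_comm (β : ℂ) (x y : Cell N d) : form β x y = form β y x := by
  have := mirrorHom_apply_id (comp β (mirrorHom (incl N d y)) (incl N d x))
  rw [mirrorHom_comp, mirrorHom_mirrorHom] at this
  exact this

/-- The through lines do not cross. -/
theorem Diagram.through_lt (D : Diagram N d) {i i' : Fin N} {j j' : Fin d}
    (h : D.1 (Sum.inr j) = Sum.inl i) (h' : D.1 (Sum.inr j') = Sum.inl i') (hj : j < j') :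
    i < i' := by
  have h1 := D.symm_apply h
  have h2 := D.symm_apply h'
  by_contra hlt
  have hne : i ≠ i' := by
    rintro rfl
    rw [h1] at h2
    exact hj.ne (Sum.inr_injective h2)
  refine D.not_cross (Sum.inl i') (Sum.inl i) ?_
  rw [h1, h2]
  simp only [pos_inl, pos_inr]
  omega

/-- Through lines preserve the order, and the only strictly increasing self-map of `Fin d` is the
identity. -/
theorem eq_id_of_isMonic {D : Diagram d d} (h : IsMonic D) : D = idDiagram d := by
  choose g hg using h
  have hmono : StrictMono g := fun j j' hj => D.through_lt (hg j) (hg j') hj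
  have hid : g = id := (hmono.range_inj strictMono_id).1 <| by
    rw [Set.range_id]
    exact (Finite.surjective_of_injective hmono.injective).range_eq
  refine Subtype.ext (funext fun x => ?_)
  rcases x with i | i
  · exact D.symm_apply (x := Sum.inr i) (by rw [hg, hid]; rfl)
  · rw [hg, hid]; rfl

/-- Every `(d, d)`-diagram other than the identity destroys a through line, so only the coefficient
that defines the form survives. -/
theorem monicPart_comp_endo (β : ℂ) (x : Hom N d) (w : Hom d d) :
    monicPart N d (comp β x w) = w (idDiagram d) • monicPart N d x := by
  induction w using Finsupp.induction_linear with
  | zero => simp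
  | add w w' hw hw' => rw [map_add, map_add, hw, hw', Finsupp.add_apply, add_smul]
  | single D c =>
    by_cases h : IsMonic D
    · obtain rfl := eq_id_of_isMonic h
      rw [Finsupp.single_eq_same, ← mul_one c, ← smul_eq_mul, ← Finsupp.smul_single, map_smul,
        comp_one, map_smul, smul_eq_mul, mul_one]
    · have hne : idDiagram d ≠ D := by
        rintro rfl
        exact h fun j => ⟨j, rfl⟩
      rw [Finsupp.single_eq_of_ne hne, zero_smul]
      rw [← monicPart_comp_incl, monicPart_single_of_not h, map_zero, map_zero, map_zero]

/-- The combination `x y*` acts on the cellular module as a rank one operator. -/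
theorem act_comp_mirror (β : ℂ) (x y z : Cell N d) :
    act β (comp β (incl N d x) (mirrorHom (incl N d y))) z = form β y z • x := by
  rw [act, comp_assoc, monicPart_comp_endo, monicPart_incl]
  rfl

end MonicDiagrams

/-! ### The Temperley–Lieb relations at the level of diagrams. -/

section Generators

variable {N d : ℕ}

/-- The links of `G` are those of the generator joining `u` and `v` on both sides. -/
structure IsGen (G : Diagram N N) (u v : Fin N) : Prop where
  ne : u ≠ v
  left : G.1 (Sum.inl u) = Sum.inl v
  right : G.1 (Sum.inr u) = Sum.inr v
  straight : ∀ x, x ≠ u → x ≠ v → G.1 (Sum.inl x) = Sum.inr x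

variable {G H : Diagram N N} {u v w : Fin N}

theorem IsGen.symm (h : IsGen G u v) : IsGen G v u :=
  ⟨h.ne.symm, G.symm_apply h.left, G.symm_apply h.right, fun x hx hx' => h.straight x hx' hx⟩

theorem IsGen.straight' (h : IsGen G u v) {x : Fin N} (hu : x ≠ u) (hv : x ≠ v) :
    G.1 (Sum.inr x) = Sum.inl x := G.symm_apply (h.straight x hu hv)

theorem IsGen.unique (h : IsGen G u v) (h' : IsGen H u v) : G = H := by
  refine Subtype.ext (funext fun x => ?_)
  rcases x with x | x
  · by_cases hu : x = u
    · rw [hu, h.left, h'.left]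
    · by_cases hv : x = v
      · rw [hv, h.symm.left, h'.symm.left]
      · rw [h.straight x hu hv, h'.straight x hu hv]
  · by_cases hu : x = u
    · rw [hu, h.right, h'.right]
    · by_cases hv : x = v
      · rw [hv, h.symm.right, h'.symm.right]
      · rw [h.straight' hu hv, h'.straight' hu hv]

theorem reach_left_of {n m p : ℕ} {D : Diagram n m} (D' : Diagram m p) {x y : Point n m}
    (h : D.1 x = y) : (glued D D').Reachable (leftV x) (leftV y) := h ▸ reach_left D D' x

theorem reach_right_of {n m p : ℕ} (D : Diagram n m) {D' : Diagram m p} {x y : Point m p}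
    (h : D'.1 x = y) : (glued D D').Reachable (Sum.inr x) (Sum.inr y) := h ▸ reach_right D D' x

theorem IsGen.reach_outer (h : IsGen G u v) (D : Diagram N d) {x : Point N d}
    (hu : x ≠ Sum.inl u) (hv : x ≠ Sum.inl v) :
    (glued G D).Reachable (outerV x) (Sum.inr x) := by
  rcases x with x | x
  · exact reach_left_of D (h.straight x (fun e => hu (by rw [e])) (fun e => hv (by rw [e])))
  · exact SimpleGraph.Reachable.refl _

theorem IsGen.reach_outer' (h : IsGen G u v) (D : Diagram N N) {x : Point N N}
    (hu : x ≠ Sum.inr u) (hv : x ≠ Sum.inr v) :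
    (glued D G).Reachable (outerV x) (leftV x) := by
  rcases x with x | x
  · exact SimpleGraph.Reachable.refl _
  · exact reach_right_of D (h.straight' (fun e => hu (by rw [e])) (fun e => hv (by rw [e])))

theorem IsGen.concat_of_arc (h : IsGen G u v) {D : Diagram N d}
    (hD : D.1 (Sum.inl u) = Sum.inl v) : concat G D = D := by
  have hD' := D.symm_apply hD
  refine Subtype.ext (funext fun x => concat_apply (D.ne_self x).symm ?_)
  by_cases hu : x = Sum.inl u
  · rw [hu, hD]; exact reach_left_of D h.left
  by_cases hv : x = Sum.inl v
  · rw [hv, hD']; exact reach_left_of D h.symm.left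
  refine ((h.reach_outer D hu hv).trans (reach_right G D x)).trans (h.reach_outer D ?_ ?_).symm
  · intro e; exact hv (by rw [← D.invol x, e, hD])
  · intro e; exact hu (by rw [← D.invol x, e, hD'])

theorem IsGen.loops_of_arc (h : IsGen G u v) {D : Diagram N d}
    (hD : D.1 (Sum.inl u) = Sum.inl v) : loops G D = 1 := by
  have hD' := D.symm_apply hD
  rw [loops, Nat.card_eq_one_iff_unique]
  have hclosed : ∀ x, (glued G D).Reachable (Sum.inr (Sum.inl u)) x →
      x = Sum.inr (Sum.inl u) ∨ x = Sum.inr (Sum.inl v) := by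
    intro x hx
    refine (eq_of_reachable G D
      (fun x => x = Sum.inr (Sum.inl u) ∨ x = Sum.inr (Sum.inl v)) ?_ ?_ hx).mp (Or.inl rfl)
    · have : ∀ y : Point N N, (leftV y : Fin N ⊕ (Fin N ⊕ Fin d)) = Sum.inr (Sum.inl u) ∨
          (leftV y : Fin N ⊕ (Fin N ⊕ Fin d)) = Sum.inr (Sum.inl v) ↔
          y = Sum.inr u ∨ y = Sum.inr v := by
        rintro (y | y) <;> simp
      intro y
      rw [this, this]
      refine propext ⟨?_, ?_⟩
      · rintro (e | e)
        · exact Or.inr (by rw [← G.invol y, e, h.right])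
        · exact Or.inl (by rw [← G.invol y, e, h.symm.right])
      · rintro (e | e)
        · exact Or.inr (by rw [e, h.right])
        · exact Or.inl (by rw [e, h.symm.right])
    · intro y
      simp only [Sum.inr.injEq]
      refine propext ⟨?_, ?_⟩
      · rintro (e | e)
        · exact Or.inr (by rw [← D.invol y, e, hD])
        · exact Or.inl (by rw [← D.invol y, e, hD'])
      · rintro (e | e)
        · exact Or.inr (by rw [e, hD])
        · exact Or.inl (by rw [e, hD'])
  constructor
  -- The loop consists of the middle points `u` and `v`; any other middle point is joined straight
  -- to the left side.
  · have main : ∀ C : (glued G D).ConnectedComponent,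
        (∀ x ∈ C.supp, ∃ j, x = Sum.inr (Sum.inl j)) →
          C = (glued G D).connectedComponentMk (Sum.inr (Sum.inl u)) := by
      intro C hC
      induction C using SimpleGraph.ConnectedComponent.ind with
      | h x =>
        obtain ⟨j, rfl⟩ := hC x rfl
        refine SimpleGraph.ConnectedComponent.sound ?_
        by_cases hu : j = u
        · rw [hu]
        by_cases hv : j = v
        · rw [hv]; exact reach_left_of D h.symm.right
        have hr : (glued G D).Reachable (Sum.inl j) (Sum.inr (Sum.inl j)) :=
          reach_left_of D (h.straight j hu hv)
        obtain ⟨i, hi⟩ := hC _ (SimpleGraph.ConnectedComponent.sound hr)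
        simp at hi
    exact ⟨fun C C' => Subtype.ext ((main C.1 C.2).trans (main C'.1 C'.2).symm)⟩
  · refine ⟨⟨(glued G D).connectedComponentMk (Sum.inr (Sum.inl u)), fun x hx => ?_⟩⟩
    rcases hclosed x (SimpleGraph.ConnectedComponent.exact hx).symm with e | e
    · exact ⟨u, e⟩
    · exact ⟨v, e⟩

section Straight

variable {D : Diagram N N}

theorem concat_gen_eq (h : IsGen G u v) (hu : D.1 (Sum.inl u) = Sum.inr u)
    (hv : D.1 (Sum.inl v) = Sum.inr v) : concat D G = concat G D := by
  have hu' := D.symm_apply hu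
  have hv' := D.symm_apply hv
  have l1 : (concat D G).1 (Sum.inl u) = Sum.inl v := concat_apply (by simpa using h.ne)
    (((reach_left_of G hu).trans (reach_right_of D h.left)).trans (reach_left_of G hv'))
  have l2 : (concat G D).1 (Sum.inl u) = Sum.inl v := concat_apply (by simpa using h.ne)
    (reach_left_of D h.left)
  have r1 : (concat D G).1 (Sum.inr u) = Sum.inr v := concat_apply (by simpa using h.ne)
    (reach_right_of D h.right)
  have r2 : (concat G D).1 (Sum.inr u) = Sum.inr v := concat_apply (by simpa using h.ne)
    (((reach_right_of G hu').trans (reach_left_of D h.right)).trans (reach_right_of G hv))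
  have off : ∀ x : Point N N, x ≠ Sum.inl u → x ≠ Sum.inl v → x ≠ Sum.inr u → x ≠ Sum.inr v →
      (concat D G).1 x = D.1 x ∧ (concat G D).1 x = D.1 x := by
    intro x h1 h2 h3 h4
    have g1 : D.1 x ≠ Sum.inl u := fun e => h3 (by rw [← D.invol x, e, hu])
    have g2 : D.1 x ≠ Sum.inl v := fun e => h4 (by rw [← D.invol x, e, hv])
    have g3 : D.1 x ≠ Sum.inr u := fun e => h1 (by rw [← D.invol x, e, hu'])
    have g4 : D.1 x ≠ Sum.inr v := fun e => h2 (by rw [← D.invol x, e, hv'])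
    exact ⟨concat_apply (D.ne_self x).symm (((h.reach_outer' D h3 h4).trans
      (reach_left D G x)).trans (h.reach_outer' D g3 g4).symm),
      concat_apply (D.ne_self x).symm (((h.reach_outer D h1 h2).trans
      (reach_right G D x)).trans (h.reach_outer D g1 g2).symm)⟩
  refine Subtype.ext (funext fun x => ?_)
  by_cases h1 : x = Sum.inl u
  · rw [h1, l1, l2]
  by_cases h2 : x = Sum.inl v
  · rw [h2, Diagram.symm_apply _ l1, Diagram.symm_apply _ l2]
  by_cases h3 : x = Sum.inr u
  · rw [h3, r1, r2]
  by_cases h4 : x = Sum.inr v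
  · rw [h4, Diagram.symm_apply _ r1, Diagram.symm_apply _ r2]
  rw [(off x h1 h2 h3 h4).1, (off x h1 h2 h3 h4).2]

theorem loops_straight_gen (h : IsGen G u v) (hu : D.1 (Sum.inl u) = Sum.inr u)
    (hv : D.1 (Sum.inl v) = Sum.inr v) : loops D G = 0 := by
  refine loops_eq_zero fun j => ?_
  by_cases h1 : j = u
  · exact ⟨Sum.inl u, by rw [h1]; exact reach_left_of G (D.symm_apply hu)⟩
  by_cases h2 : j = v
  · exact ⟨Sum.inl v, by rw [h2]; exact reach_left_of G (D.symm_apply hv)⟩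
  exact ⟨Sum.inr j, reach_right_of D (h.straight j h1 h2)⟩

theorem loops_gen_straight (h : IsGen G u v) (hu : D.1 (Sum.inl u) = Sum.inr u)
    (hv : D.1 (Sum.inl v) = Sum.inr v) : loops G D = 0 := by
  refine loops_eq_zero fun j => ?_
  by_cases h1 : j = u
  · exact ⟨Sum.inr u, by rw [h1]; exact reach_right_of G hu⟩
  by_cases h2 : j = v
  · exact ⟨Sum.inr v, by rw [h2]; exact reach_right_of G hv⟩
  exact ⟨Sum.inl j, reach_left_of D (h.straight' h1 h2)⟩

end Straight

section Neighbours

theorem concat_neighbours (hG : IsGen G u v) (hH : IsGen H v w) (huw : u ≠ w) :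
    (concat H G).1 (Sum.inl u) = Sum.inr w :=
  concat_apply (by simp) ((((reach_left_of G (hH.straight u hG.ne huw)).trans
    (reach_right_of H hG.left)).trans (reach_left_of G hH.right)).trans
    (reach_right_of H (hG.straight w huw.symm hH.ne.symm)))

theorem loops_neighbours (hG : IsGen G u v) (hH : IsGen H v w) (huw : u ≠ w) :
    loops H G = 0 := by
  have hu := reach_left_of G (hH.straight' hG.ne huw)
  refine loops_eq_zero fun j => ?_
  by_cases h1 : j = u
  · exact ⟨Sum.inl u, by rw [h1]; exact hu⟩
  by_cases h2 : j = v
  · exact ⟨Sum.inl u, by rw [h2]; exact (reach_right_of H hG.symm.left).trans hu⟩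
  exact ⟨Sum.inr j, reach_right_of H (hG.straight j h1 h2)⟩

theorem concat_neighbours_off (hG : IsGen G u v) (hH : IsGen H v w) {x : Fin N}
    (h1 : x ≠ u) (h2 : x ≠ v) (h3 : x ≠ w) :
    (concat H G).1 (Sum.inl x) = Sum.inr x :=
  concat_apply (by simp) ((reach_left_of G (hH.straight x h2 h3)).trans
    (reach_right_of H (hG.straight x h1 h2)))

/-- This is the relation `E_i E_{i±1} E_i = E_i`. The only curve that needs care is the one from
`w`, which zigzags through `v` and `u` before coming back to `w`. -/
theorem concat_gen_neighbours (hG : IsGen G u v) (hH : IsGen H v w) (huw : u ≠ w) :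
    concat G (concat H G) = G := by
  have a1 := concat_neighbours hG hH huw
  have a2 : (concat H G).1 (Sum.inl v) = Sum.inl w :=
    concat_apply (by simpa using hH.ne) (reach_left_of G hH.left)
  have a3 : (concat H G).1 (Sum.inr u) = Sum.inr v :=
    concat_apply (by simpa using hG.ne) (reach_right_of H hG.right)
  refine IsGen.unique ⟨hG.ne, ?_, ?_, fun x h1 h2 => ?_⟩ hG
  · exact concat_apply (by simpa using hG.ne) (reach_left_of _ hG.left)
  · exact concat_apply (by simpa using hG.ne) (reach_right_of _ a3)
  · by_cases h3 : x = w
    · rw [h3]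
      exact concat_apply (by simp) ((((reach_left_of _ (hG.straight w huw.symm hH.ne.symm)).trans
        (reach_right_of _ (Diagram.symm_apply _ a2))).trans (reach_left_of _ hG.symm.right)).trans
        (reach_right_of _ a1))
    · exact concat_apply (by simp) ((reach_left_of _ (hG.straight x h1 h2)).trans
        (reach_right_of _ (concat_neighbours_off hG hH h1 h2 h3)))

theorem loops_gen_neighbours (hG : IsGen G u v) (hH : IsGen H v w) (huw : u ≠ w) :
    loops G (concat H G) = 0 := by
  have a1 := concat_neighbours hG hH huw
  have hu := reach_right_of G a1
  refine loops_eq_zero fun j => ?_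
  by_cases h1 : j = u
  · exact ⟨Sum.inr w, by rw [h1]; exact hu⟩
  by_cases h2 : j = v
  · exact ⟨Sum.inr w, by rw [h2]; exact (reach_left_of _ hG.symm.right).trans hu⟩
  · exact ⟨Sum.inl j, reach_left_of _ (hG.straight' h1 h2)⟩

end Neighbours

/-- The generator joining the points `i` and `i + 1`. -/
abbrev gen (N i : ℕ) (h : i + 1 < N) : Diagram N N := ⟨genFun N i h, genFun_isPlanarMatching N i h⟩

theorem isGen_gen (N i : ℕ) (h : i + 1 < N) :
    IsGen (gen N i h) ⟨i, by omega⟩ ⟨i + 1, h⟩ := by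
  refine ⟨by simp, by simp [genFun], by simp [genFun], fun x h1 h2 => ?_⟩
  rw [Ne, Fin.ext_iff] at h1 h2
  simp only [genFun, if_neg h1, if_neg h2]

end Generators

/-! ### Wenzl–Jones projectors in an abstract ring. -/

section WenzlJones

variable {A : Type*} [Ring A] [Algebra ℂ A]

/-- By the recursion, `p j` is a polynomial in `f 1, …, f (j - 1)`. -/
theorem commute_of_recursion {c : ℕ → ℂ} {f p : ℕ → A} (hp1 : p 1 = 1)
    (hp : ∀ j, 1 ≤ j → p (j + 1) = p j - c j • (p j * f j * p j)) {x : A} {j : ℕ} (hj : 1 ≤ j)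
    (hx : ∀ i, 1 ≤ i → i < j → Commute x (f i)) : Commute x (p j) := by
  induction j, hj using Nat.le_induction with
  | base => rw [hp1]; exact Commute.one_right x
  | succ j hj ih =>
    have h := ih fun i h1 h2 => hx i h1 (by omega)
    rw [hp j hj]
    exact h.sub_right (((h.mul_right (hx j hj (by omega))).mul_right h).smul_right (c j))

/-- The properties of the Wenzl-Jones projectors, for elements `f i` that satisfy the
Temperley-Lieb relations. -/
theorem wenzlJones_properties {β : ℂ} {c e : ℕ → ℂ} {f p : ℕ → A} {k : ℕ} (hp0 : p 0 = 1)
    (hp1 : p 1 = 1) (hp : ∀ j, 1 ≤ j → p (j + 1) = p j - c j • (p j * f j * p j))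
    (he1 : e 1 = β) (he : ∀ j, 1 ≤ j → j + 1 < k → e (j + 1) = β - c j)
    (hce : ∀ j, 1 ≤ j → j < k → c j * e j = 1)
    (hsq : ∀ j, 1 ≤ j → j < k → f j * f j = β • f j)
    (hbr : ∀ j, 1 ≤ j → j + 1 < k → f (j + 1) * f j * f (j + 1) = f (j + 1))
    (hfar : ∀ i j, 1 ≤ i → i + 1 < j → j < k → Commute (f j) (f i))
    {j : ℕ} (hj : 1 ≤ j) (hjk : j ≤ k) :
    p j * p j = p j ∧ p (j - 1) * p j = p j ∧ p j * p (j - 1) = p j ∧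
      (∀ i, 1 ≤ i → i < j → f i * p j = 0 ∧ p j * f i = 0) ∧
      (j < k → f j * p j * f j = e j • (f j * p (j - 1))) := by
  induction j, hj using Nat.le_induction with
  | base =>
    refine ⟨by simp [hp1], by simp [hp1, hp0], by simp [hp1, hp0],
      fun i h1 h2 => by omega, fun h => ?_⟩
    simp only [hp1, mul_one, Nat.sub_self, hp0, he1]
    exact hsq 1 le_rfl h
  | succ j hj ih =>
    obtain ⟨i1, i2, i2', i3, i4⟩ := ih (by omega)
    have i4 := i4 (by omega)
    have hc : c j * e j = 1 := hce j hj (by omega)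
    have hcomm0 : Commute (f j) (p (j - 1)) := by
      rcases Nat.eq_or_lt_of_le hj with h | h
      · rw [← h, Nat.sub_self, hp0]; exact Commute.one_right _
      · exact commute_of_recursion hp1 hp (by omega)
          fun i h1 h2 => hfar i j h1 (by omega) (by omega)
    set P := p j with hP
    set F := f j with hF
    have q1 : P * (P * F * P) = P * F * P := by rw [← mul_assoc, ← mul_assoc, i1]
    have q2 : P * F * P * P = P * F * P := by rw [mul_assoc, i1]
    have q3 : P * F * P * (P * F * P) = e j • (P * F * P) := by
      calc P * F * P * (P * F * P) = P * F * (P * P) * F * P := by noncomm_ring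
        _ = P * (F * P * F) * P := by rw [i1]; noncomm_ring
        _ = e j • (P * F * (p (j - 1) * P)) := by
          rw [i4, mul_smul_comm, smul_mul_assoc]; congr 1; noncomm_ring
        _ = _ := by rw [i2]
    have hrec := hp j hj
    rw [← hP, ← hF] at hrec
    have z1 : F * (P * F * P) = e j • (F * P) := by
      calc F * (P * F * P) = F * P * F * P := by noncomm_ring
        _ = e j • (F * (p (j - 1) * P)) := by rw [i4, smul_mul_assoc, mul_assoc]
        _ = _ := by rw [i2]
    have z2 : P * F * P * F = e j • (P * F) := by
      calc P * F * P * F = P * (F * P * F) := by noncomm_ring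
        _ = e j • (P * (p (j - 1) * F)) := by rw [i4, mul_smul_comm, hcomm0.eq]
        _ = _ := by rw [← mul_assoc, i2']
    -- With `X = P F P` one has `X² = e_j X`, so the square is `P - 2 c_j X + c_j² e_j X`, which
    -- equals `P - c_j X` because `c_j e_j = 1`.
    have idem : p (j + 1) * p (j + 1) = p (j + 1) := by
      rw [hrec, sub_mul, mul_sub, mul_sub, i1, smul_mul_assoc, smul_mul_assoc, mul_smul_comm,
        mul_smul_comm, q1, q2, q3, smul_smul, smul_smul, mul_assoc (c j), hc, mul_one]
      abel
    have absorb : P * p (j + 1) = p (j + 1) := by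
      rw [hrec, mul_sub, mul_smul_comm, i1, q1]
    have absorb' : p (j + 1) * P = p (j + 1) := by
      rw [hrec, sub_mul, smul_mul_assoc, i1, q2]
    refine ⟨idem, by simpa using absorb, by simpa using absorb', ?_, ?_⟩
    · intro i h1 h2
      rcases Nat.eq_or_lt_of_le (Nat.le_of_lt_succ h2) with h | h
      · rw [h, hrec, mul_sub, sub_mul, mul_smul_comm, smul_mul_assoc, z1, z2, smul_smul, smul_smul,
          hc, one_smul, one_smul, sub_self, sub_self]
        exact ⟨rfl, rfl⟩
      · obtain ⟨a, b⟩ := i3 i h1 h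
        constructor
        · rw [hrec, mul_sub, mul_smul_comm, mul_assoc P, ← mul_assoc (f i), a, zero_mul, smul_zero,
            sub_zero]
        · rw [hrec, sub_mul, smul_mul_assoc, mul_assoc _ P, b, mul_zero, smul_zero, sub_zero]
    -- Since `f (j + 1)` commutes with `p j`, the two terms of the recursion contribute `β` and `c
    -- j`, through the square and braid relations; their difference is `e (j + 1)`.
    · intro hk
      have hcomm : Commute (f (j + 1)) P :=
        commute_of_recursion hp1 hp hj fun i h1 h2 => hfar i (j + 1) h1 (by omega) hk
      rw [Nat.add_sub_cancel, ← hP, he j hj hk, hrec, mul_sub, sub_mul, mul_smul_comm,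
        smul_mul_assoc]
      have t1 : f (j + 1) * P * f (j + 1) = β • (f (j + 1) * P) := by
        rw [mul_assoc, ← hcomm.eq, ← mul_assoc, hsq _ (by omega) hk, smul_mul_assoc]
      have t2 : f (j + 1) * (P * F * P) * f (j + 1) = f (j + 1) * P := by
        calc f (j + 1) * (P * F * P) * f (j + 1) = f (j + 1) * P * F * (P * f (j + 1)) := by
              noncomm_ring
          _ = P * (f (j + 1) * F * f (j + 1)) * P := by
              rw [← hcomm.eq]
              nth_rewrite 1 [hcomm.eq]
              noncomm_ring
          _ = f (j + 1) * P := by rw [hbr j hj hk, ← hcomm.eq, mul_assoc, i1]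
      rw [t1, t2, sub_smul]

end WenzlJones

/-! ### The projector `P_k` and the vanishing of `P_k w`. -/

section SeamProjector

variable {n k N d : ℕ} {q : ℂ}

/-- A zero of the numerator gives `q ^ (2 * i) = 1` with `i ≤ k`. The case `i = 1` takes care of the
denominator. -/
theorem qnum_ne_zero (hq0 : q ≠ 0) (hk : 2 ≤ k) (hq : ∀ l : ℕ, 0 < l → q ^ (2 * l) = 1 → k < l)
    {j : ℕ} (hj : 1 ≤ j) (hjk : j ≤ k) : qnum q j ≠ 0 := by
  have h : ∀ i : ℕ, 1 ≤ i → i ≤ k → q ^ i - (q ^ i)⁻¹ ≠ 0 := by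
    intro i h1 h2 h3
    have h4 : q ^ i * q ^ i = 1 := by
      nth_rewrite 2 [sub_eq_zero.1 h3]
      exact mul_inv_cancel₀ (pow_ne_zero i hq0)
    have := hq i (by omega) (by rw [two_mul, pow_add, h4])
    omega
  have h1 := h 1 le_rfl (by omega)
  rw [pow_one] at h1
  exact div_ne_zero (h j hj hjk) h1

theorem qnum_one (h : q - q⁻¹ ≠ 0) : qnum q 1 = 1 := by
  rw [qnum, pow_one, div_self h]

theorem qnum_succ_succ (hq0 : q ≠ 0) (j : ℕ) :
    qnum q (j + 2) = (q + q⁻¹) * qnum q (j + 1) - qnum q j := by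
  simp only [qnum, ← mul_div_assoc, ← sub_div]
  congr 1
  field_simp
  ring

/-- Left multiplication by an element of the Temperley-Lieb algebra. -/
def mulLeft (β : ℂ) (N : ℕ) : TL N →ₗ[ℂ] Module.End ℂ (TL N) := comp β

theorem mulLeft_comp (β : ℂ) (a b : TL N) :
    mulLeft β N (comp β a b) = mulLeft β N a * mulLeft β N b :=
  LinearMap.ext fun x => comp_assoc β a b x

theorem mulLeft_one (β : ℂ) : mulLeft β N (one N) = 1 := LinearMap.ext fun x => one_comp β x

/-- The left regular representation is faithful, since an element is recovered from its action on
the unit. Identities between projectors can be proved in the endomorphism ring and pulled back. -/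
theorem mulLeft_injective (β : ℂ) : Function.Injective (mulLeft β N) := fun a b h => by
  have := LinearMap.congr_fun h (one N)
  simpa [mulLeft] using this

theorem E_eq {i : ℕ} (h : i + 1 < N) : E N (i + 1) = Finsupp.single (gen N i h) 1 := by
  rw [E, dif_pos ⟨by omega, h⟩]
  rfl

/-- The operator of multiplication by the generator acting on the points `j` and `j + 1` from the
bottom. -/
def genOp (β : ℂ) (N j : ℕ) : Module.End ℂ (TL N) := mulLeft β N (E N (N - (j + 1) + 1))

theorem genOp_eq (β : ℂ) {j : ℕ} (h1 : 1 ≤ j) (h : j < N) :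
    genOp β N j = mulLeft β N (Finsupp.single (gen N (N - (j + 1)) (by omega)) 1) := by
  rw [genOp, E_eq]

theorem mulLeft_wenzlJones_succ (q : ℂ) {j : ℕ} (h1 : 1 ≤ j) :
    mulLeft (q + q⁻¹) N (wenzlJones q N (j + 1)) = mulLeft (q + q⁻¹) N (wenzlJones q N j) -
      (qnum q j / qnum q (j + 1)) • (mulLeft (q + q⁻¹) N (wenzlJones q N j) *
        genOp (q + q⁻¹) N j * mulLeft (q + q⁻¹) N (wenzlJones q N j)) := by
  obtain ⟨j, rfl⟩ := Nat.exists_eq_add_of_le' h1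
  rw [wenzlJones, map_sub, map_smul, mulLeft_comp, mulLeft_comp, genOp]

theorem mulLeft_single_mul (β : ℂ) (D D' : Diagram N N) :
    mulLeft β N (Finsupp.single D 1) * mulLeft β N (Finsupp.single D' 1) =
      β ^ loops D D' • mulLeft β N (Finsupp.single (concat D D') 1) := by
  rw [← mulLeft_comp, comp_single, ← map_smul, Finsupp.smul_single]
  simp

theorem isGen_gen' {j : ℕ} (h1 : 1 ≤ j) (h : j < N) :
    IsGen (gen N (N - (j + 1)) (by omega)) ⟨N - (j + 1), by omega⟩ ⟨N - j, by omega⟩ := by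
  have := isGen_gen N (N - (j + 1)) (by omega)
  convert this using 2
  omega

theorem genOp_sq (β : ℂ) {j : ℕ} (h1 : 1 ≤ j) (h : j < N) :
    genOp β N j * genOp β N j = β • genOp β N j := by
  have hg := isGen_gen' h1 h
  rw [genOp_eq β h1 h, mulLeft_single_mul, hg.concat_of_arc hg.left, hg.loops_of_arc hg.left,
    pow_one]

theorem genOp_braid (β : ℂ) {j : ℕ} (h1 : 1 ≤ j) (h : j + 1 < N) :
    genOp β N (j + 1) * genOp β N j * genOp β N (j + 1) = genOp β N (j + 1) := by
  have hj := isGen_gen' h1 (by omega : j < N)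
  have hj' := isGen_gen' (by omega : 1 ≤ j + 1) h
  have hne : (⟨N - (j + 1 + 1), by omega⟩ : Fin N) ≠ ⟨N - j, by omega⟩ := by
    rw [Ne, Fin.mk.injEq]; omega
  rw [mul_assoc, genOp_eq β h1 (by omega), genOp_eq β (by omega) h, mulLeft_single_mul,
    loops_neighbours hj' hj hne, pow_zero, one_smul, mulLeft_single_mul,
    loops_gen_neighbours hj' hj hne, concat_gen_neighbours hj' hj hne, pow_zero, one_smul]

theorem commute_genOp (β : ℂ) {D : Diagram N N} {j : ℕ} (h1 : 1 ≤ j) (h : j < N)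
    (hD : ∀ i : Fin N, i.val = N - (j + 1) ∨ i.val = N - j → D.1 (Sum.inl i) = Sum.inr i) :
    Commute (mulLeft β N (Finsupp.single D 1)) (genOp β N j) := by
  have hg := isGen_gen' h1 h
  have hu := hD ⟨N - (j + 1), by omega⟩ (Or.inl rfl)
  have hv := hD ⟨N - j, by omega⟩ (Or.inr rfl)
  rw [Commute, SemiconjBy, genOp_eq β h1 h, mulLeft_single_mul, mulLeft_single_mul,
    loops_straight_gen hg hu hv, loops_gen_straight hg hu hv, concat_gen_eq hg hu hv]

theorem genOp_far (β : ℂ) {i j : ℕ} (h1 : 1 ≤ i) (h : i + 1 < j) (hj : j < N) :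
    Commute (genOp β N j) (genOp β N i) := by
  rw [genOp_eq β (by omega) hj]
  refine commute_genOp β h1 (by omega) fun x hx => ?_
  refine (isGen_gen' (by omega : 1 ≤ j) hj).straight x ?_ ?_ <;>
  · rw [Ne, Fin.ext_iff]
    dsimp only
    omega

/-- Here `c_j = [j]/[j+1]` and `e_j = [j+1]/[j]`, so that `e_{j+1} = β - c_j` is the recursion
`[j+2] = β [j+1] - [j]` divided by `[j+1]`. -/
theorem seamProj_mul (hq0 : q ≠ 0) (hn : 1 ≤ n) (hk : 2 ≤ k)
    (hq : ∀ l : ℕ, 0 < l → q ^ (2 * l) = 1 → k < l) :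
    let P := mulLeft (q + q⁻¹) (n + k) (seamProj q n k)
    P * P = P ∧ ∀ i, 1 ≤ i → i < k → P * genOp (q + q⁻¹) (n + k) i = 0 := by
  have hne : ∀ {j}, 1 ≤ j → j ≤ k → qnum q j ≠ 0 := fun h h' => qnum_ne_zero hq0 hk hq h h'
  have hqq : q - q⁻¹ ≠ 0 := by
    intro h
    refine hne le_rfl (by omega) (j := 1) ?_
    rw [qnum, h, div_zero]
  obtain ⟨h1, -, -, h2, -⟩ := wenzlJones_properties (A := Module.End ℂ (TL (n + k)))
    (β := q + q⁻¹) (c := fun j => qnum q j / qnum q (j + 1))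
    (e := fun j => qnum q (j + 1) / qnum q j) (f := genOp (q + q⁻¹) (n + k))
    (p := fun j => mulLeft (q + q⁻¹) (n + k) (wenzlJones q (n + k) j)) (k := k) (mulLeft_one _)
    (mulLeft_one _) (fun j hj => mulLeft_wenzlJones_succ q hj)
    (by
      have := qnum_succ_succ hq0 0
      simp only [zero_add, qnum_one hqq] at this ⊢
      rw [this]
      simp [qnum])
    (fun j hj hjk => by
      have := hne (j := j + 1) (by omega) (by omega)
      rw [qnum_succ_succ hq0]
      field_simp)
    (fun j hj hjk => by
      have h1 := hne hj (by omega)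
      have h2 := hne (j := j + 1) (by omega) (by omega)
      field_simp)
    (fun j hj hjk => genOp_sq _ hj (by omega))
    (fun j hj hjk => genOp_braid _ hj (by omega))
    (fun i j hi hij hj => genOp_far _ hi hij (by omega)) (by omega : 1 ≤ k) le_rfl
  exact ⟨h1, fun i hi hik => (h2 i hi hik).2⟩

theorem seamProj_idem (hq0 : q ≠ 0) (hn : 1 ≤ n) (hk : 2 ≤ k)
    (hq : ∀ l : ℕ, 0 < l → q ^ (2 * l) = 1 → k < l) :
    comp (q + q⁻¹) (seamProj q n k) (seamProj q n k) = seamProj q n k :=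
  mulLeft_injective (q + q⁻¹) <| by
    rw [mulLeft_comp]; exact (seamProj_mul hq0 hn hk hq).1

theorem seamProj_gen (hq0 : q ≠ 0) (hn : 1 ≤ n) (hk : 2 ≤ k)
    (hq : ∀ l : ℕ, 0 < l → q ^ (2 * l) = 1 → k < l) {i : ℕ} (hi : n ≤ i) (h : i + 1 < n + k) :
    comp (q + q⁻¹) (seamProj q n k) (Finsupp.single (gen (n + k) i h) 1) = 0 := by
  refine mulLeft_injective (q + q⁻¹) ?_
  obtain ⟨j, rfl⟩ : ∃ j, i = n + k - (j + 1) := ⟨n + k - (i + 1), by omega⟩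
  have := (seamProj_mul hq0 hn hk hq).2 j (by omega) (by omega)
  rw [genOp_eq _ (by omega) (by omega)] at this
  rw [mulLeft_comp, this, map_zero]

/-- `P_k` is built from generators acting on boundary points only, and each of them commutes with a
diagram that is straight there. -/
theorem seamProj_comm (hn : 1 ≤ n) (hk : 2 ≤ k) {D : Diagram (n + k) (n + k)}
    (hD : IsStraightOnBoundary n k D) :
    comp (q + q⁻¹) (Finsupp.single D 1) (seamProj q n k) =
      comp (q + q⁻¹) (seamProj q n k) (Finsupp.single D 1) := by
  refine mulLeft_injective (q + q⁻¹) ?_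
  rw [mulLeft_comp, mulLeft_comp]
  exact commute_of_recursion (c := fun j => qnum q j / qnum q (j + 1))
    (f := genOp (q + q⁻¹) (n + k))
    (p := fun j => mulLeft (q + q⁻¹) (n + k) (wenzlJones q (n + k) j)) (mulLeft_one _)
    (fun j hj => mulLeft_wenzlJones_succ q hj) (by omega : 1 ≤ k)
    fun i h1 h2 => commute_genOp _ h1 (by omega) fun x hx => hD x (by omega)

/-- The combinations of diagrams with a left arc joining two boundary points. -/
def arcSpan (n k d : ℕ) : Submodule ℂ (Hom (n + k) d) :=
  Submodule.span ℂ {x | ∃ (D : Diagram (n + k) d) (a b : Fin (n + k)), n ≤ a.val ∧ n ≤ b.val ∧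
    D.1 (Sum.inl a) = Sum.inl b ∧ x = Finsupp.single D 1}

/-- Left arcs survive composition on the right, so these spans behave like a right ideal. -/
theorem comp_mem_arcSpan (β : ℂ) {m d : ℕ} {x : Hom (n + k) m} (hx : x ∈ arcSpan n k m)
    (y : Hom m d) : comp β x y ∈ arcSpan n k d := by
  induction hx using Submodule.span_induction with
  | zero => simp
  | add x x' _ _ h h' => rw [map_add, LinearMap.add_apply]; exact add_mem h h'
  | smul c x _ h => rw [map_smul, LinearMap.smul_apply]; exact Submodule.smul_mem _ _ h
  | mem x hx =>
    obtain ⟨D, a, b, ha, hb, hab, rfl⟩ := hx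
    induction y using Finsupp.induction_linear with
    | zero => simp
    | add y y' h h' => rw [map_add]; exact add_mem h h'
    | single D' c =>
      rw [comp_single, ← mul_one (1 * c * _), ← smul_eq_mul, ← Finsupp.smul_single]
      refine Submodule.smul_mem _ _ (Submodule.subset_span ⟨_, a, b, ha, hb, ?_, rfl⟩)
      refine concat_apply ?_ (reach_left_of D' hab)
      rintro h
      exact D.ne_self (Sum.inl a) (by rw [hab, Sum.inl_injective h])

theorem seamProj_sub_one_mem (n k : ℕ) (q : ℂ) (hn : 1 ≤ n) (hk : 2 ≤ k) :
    seamProj q n k - one (n + k) ∈ arcSpan n k (n + k) := by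
  have main : ∀ j, 1 ≤ j → j ≤ k → wenzlJones q (n + k) j - one (n + k) ∈ arcSpan n k (n + k) := by
    intro j h1
    induction j, h1 using Nat.le_induction with
    | base => intro _; simp [wenzlJones]
    | succ j hj ih =>
      intro hjk
      obtain ⟨i, rfl⟩ := Nat.exists_eq_add_of_le' hj
      have ih := ih (by omega)
      rw [wenzlJones, sub_right_comm]
      refine sub_mem ih (Submodule.smul_mem _ _ (comp_mem_arcSpan _ ?_ _))
      have hE : E (n + k) (n + k - (i + 2) + 1) ∈ arcSpan n k (n + k) := by
        rw [E_eq (by omega)]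
        have hg := isGen_gen (n + k) (n + k - (i + 2)) (by omega)
        exact Submodule.subset_span ⟨_, _, _, by dsimp only; omega, by dsimp only; omega,
          hg.left, rfl⟩
      have := add_mem (comp_mem_arcSpan (q + q⁻¹) ih (E (n + k) (n + k - (i + 2) + 1))) hE
      rwa [map_sub, LinearMap.sub_apply, one_comp, sub_add_cancel] at this
  exact main k (by omega) le_rfl

/-- No link joins two left boundary points. -/
def NoBoundaryArc (n k : ℕ) {d : ℕ} (D : Diagram (n + k) d) : Prop :=
  ∀ a b : Fin (n + k), n ≤ a.val → n ≤ b.val → D.1 (Sum.inl a) ≠ Sum.inl b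

/-- Modulo diagrams with a boundary arc, `P_k` is the identity; hence `w` has coefficient `1` in
`P_k w`. -/
theorem seamVec_ne_zero (hn : 1 ≤ n) (hk : 2 ≤ k) {w : Monic (n + k) d}
    (hw : NoBoundaryArc n k w.1) : seamVec q n k w ≠ 0 := by
  intro h
  have hval : ∀ x ∈ arcSpan n k d, x w.1 = 0 := by
    intro x hx
    induction hx using Submodule.span_induction with
    | zero => rfl
    | add x x' _ _ h h' => rw [Finsupp.add_apply, h, h', add_zero]
    | smul c x _ h => rw [Finsupp.smul_apply, h, smul_zero]
    | mem x hx =>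
      obtain ⟨D, a, b, ha, hb, hab, rfl⟩ := hx
      refine Finsupp.single_eq_of_ne ?_
      rintro rfl
      exact hw a b ha hb hab
  have h1 := hval _ (comp_mem_arcSpan (q + q⁻¹) (seamProj_sub_one_mem n k q hn hk)
    (Finsupp.single w.1 1))
  rw [map_sub, LinearMap.sub_apply, one_comp, Finsupp.sub_apply, Finsupp.single_eq_same] at h1
  have h2 := DFunLike.congr_fun h w
  rw [seamVec, act, incl_single, monicPart_apply, Finsupp.zero_apply] at h2
  rw [h2] at h1
  norm_num at h1

/-- A link joining two left points encloses a link joining two consecutive left points. -/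
theorem exists_small_arc (D : Diagram N d) (l : ℕ) : ∀ a b : Fin N, a < b → b.val - a.val ≤ l →
    D.1 (Sum.inl a) = Sum.inl b →
    ∃ (i : ℕ) (h : i + 1 < N), a.val ≤ i ∧ D.1 (Sum.inl ⟨i, by omega⟩) = Sum.inl ⟨i + 1, h⟩ := by
  induction l with
  | zero => intro a b h1 h2; omega
  | succ l ih =>
    intro a b h1 h2 h3
    by_cases h : b.val = a.val + 1
    · exact ⟨a.val, by omega, le_rfl, by rw [Fin.eta, h3]; congr 1; exact Fin.ext h⟩
    · have hlt : a.val + 1 < N := by omega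
      have hm := D.pos_mem (x := Sum.inl a) (u := Sum.inl ⟨a.val + 1, hlt⟩) (by simp)
        (by rw [h3]; simp only [pos_inl]; omega)
      rw [h3] at hm
      rcases hc : D.1 (Sum.inl ⟨a.val + 1, hlt⟩) with c | c
      · have hne : c.val ≠ a.val + 1 := fun h => D.ne_self (Sum.inl ⟨a.val + 1, hlt⟩) (by
          rw [hc]; congr 1; exact Fin.ext h)
        simp only [hc, pos_inl] at hm
        obtain ⟨i, hi, h5, h6⟩ := ih ⟨a.val + 1, hlt⟩ c (by rw [Fin.lt_def]; dsimp only; omega)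
          (by dsimp only; omega) hc
        exact ⟨i, hi, by dsimp only at h5; omega, h6⟩
      · simp only [hc, pos_inl, pos_inr] at hm
        omega

/-- A boundary arc encloses an arc between neighbours `i`, `i + 1`. The generator on them multiplies
`w` by `β` and is killed by `P_k`, while `β = [2]` is non-zero. -/
theorem noBoundaryArc_of_seamVec_ne_zero (hq0 : q ≠ 0) (hn : 1 ≤ n) (hk : 2 ≤ k)
    (hq : ∀ l : ℕ, 0 < l → q ^ (2 * l) = 1 → k < l) {w : Monic (n + k) d}
    (hw : seamVec q n k w ≠ 0) : NoBoundaryArc n k w.1 := by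
  intro a b ha hb hab
  wlog hlt : a < b generalizing a b
  · refine this b a hb ha (w.1.symm_apply hab) (lt_of_le_of_ne (not_lt.1 hlt) ?_)
    rintro rfl
    exact w.1.ne_self _ hab
  obtain ⟨i, hi, h1, h2⟩ := exists_small_arc w.1 _ a b hlt le_rfl hab
  have hg := isGen_gen (n + k) i hi
  have hβ : q + q⁻¹ ≠ 0 := by
    intro h
    refine qnum_ne_zero hq0 hk hq (j := 2) (by omega) hk ?_
    have h1 := qnum_succ_succ hq0 0
    rw [h, zero_mul, zero_sub] at h1
    simpa [qnum] using h1
  have h3 : act (q + q⁻¹) (Finsupp.single (gen (n + k) i hi) 1) (Finsupp.single w 1) =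
      (q + q⁻¹) • Finsupp.single w (1 : ℂ) := by
    rw [act, incl_single, comp_single, hg.concat_of_arc h2, hg.loops_of_arc h2, monicPart_single,
      Finsupp.smul_single]
    simp
  have h4 : act (q + q⁻¹) (seamProj q n k) ((q + q⁻¹) • Finsupp.single w (1 : ℂ)) = 0 := by
    rw [← h3, act_act, seamProj_gen hq0 hn hk hq (by omega) hi, act_eq, map_zero,
      LinearMap.zero_apply]
  rw [act_eq, map_smul] at h4
  exact hw ((smul_eq_zero.1 h4).resolve_left hβ)

end SeamProjector

/-! ### The nested diagram. -/

/-- The sizes occurring in the nested diagram: it has `m` arcs, `s` through lines above the arcs and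
`e` arcs that join two bulk points. -/
structure NestedData (n k d : ℕ) where
  m : ℕ
  e : ℕ
  s : ℕ
  hn : 1 ≤ n
  hk : 2 ≤ k
  hN : n + k = d + 2 * m
  he : e = m - k
  hs : s + m + e = n

namespace NestedData

variable {n k d : ℕ} (c : NestedData n k d)

/-- When `m ≤ k`, the condition `k ≤ n + d` is what gives `m ≤ n`, so that `s = n - m` is an honest
difference. When `m > k`, one gets `s = d`. -/
theorem exists_of_mem (hn : 1 ≤ n) (hk : 2 ≤ k) (hd : d ∈ seamIndex n k) :
    Nonempty (NestedData n k d) := by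
  obtain ⟨h1, h2, h3⟩ := hd
  rw [Nat.ModEq] at h2
  exact ⟨⟨(n + k - d) / 2, (n + k - d) / 2 - k, n - (n + k - d) / 2 - ((n + k - d) / 2 - k), hn, hk,
    by omega, rfl, by omega⟩⟩

theorem s_le : c.s ≤ d := by
  have := c.hN; have := c.he; have := c.hs; omega

/-- The links of the nested diagram. -/
def zFun : Point (n + k) d → Point (n + k) d
  | Sum.inl x =>
      if h : x.val < c.s then Sum.inr ⟨x.val, h.trans_le c.s_le⟩
      else if h' : x.val < c.s + 2 * c.m then
        Sum.inl ⟨2 * c.s + 2 * c.m - 1 - x.val, by have := c.hN; have := c.s_le; omega⟩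
      else Sum.inr ⟨x.val - 2 * c.m, by have := c.hN; omega⟩
  | Sum.inr y =>
      if y.val < c.s then Sum.inl ⟨y.val, by have := c.hN; omega⟩
      else Sum.inl ⟨y.val + 2 * c.m, by have := c.hN; omega⟩

theorem zFun_inl_top {x : Fin (n + k)} (h : x.val < c.s) :
    c.zFun (Sum.inl x) = Sum.inr ⟨x.val, h.trans_le c.s_le⟩ := by
  rw [zFun, dif_pos h]

theorem zFun_inl_mid {x y : Fin (n + k)} (h : c.s ≤ x.val) (h' : x.val < c.s + 2 * c.m)
    (hxy : x.val + y.val + 1 = 2 * c.s + 2 * c.m) : c.zFun (Sum.inl x) = Sum.inl y := by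
  rw [zFun, dif_neg (by omega), dif_pos h']
  congr 1
  exact Fin.ext (by dsimp only; omega)

theorem zFun_inl_bot {x : Fin (n + k)} (h : c.s + 2 * c.m ≤ x.val) :
    c.zFun (Sum.inl x) = Sum.inr ⟨x.val - 2 * c.m, by have := c.hN; omega⟩ := by
  rw [zFun, dif_neg (by omega), dif_neg (by omega)]

theorem zFun_isPlanarMatching : IsPlanarMatching c.zFun := by
  have hN := c.hN
  have hs := c.s_le
  obtain ⟨z1, z2⟩ : (∀ x : Fin (n + k),
      (∃ y : Fin d, c.zFun (Sum.inl x) = Sum.inr y ∧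
        (x.val < c.s ∧ y.val = x.val ∨ c.s + 2 * c.m ≤ x.val ∧ y.val + 2 * c.m = x.val)) ∨
      ∃ y : Fin (n + k), c.zFun (Sum.inl x) = Sum.inl y ∧ c.s ≤ x.val ∧ x.val < c.s + 2 * c.m ∧
        x.val + y.val + 1 = 2 * c.s + 2 * c.m) ∧
      ∀ y : Fin d, ∃ x : Fin (n + k), c.zFun (Sum.inr y) = Sum.inl x ∧
        (x.val < c.s ∧ y.val = x.val ∨ c.s + 2 * c.m ≤ x.val ∧ y.val + 2 * c.m = x.val) := by
    constructor
    · intro x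
      by_cases h1 : x.val < c.s
      · exact Or.inl ⟨_, c.zFun_inl_top h1, Or.inl ⟨h1, rfl⟩⟩
      · by_cases h2 : x.val < c.s + 2 * c.m
        · refine Or.inr ⟨⟨2 * c.s + 2 * c.m - 1 - x.val, by omega⟩,
            c.zFun_inl_mid (by omega) h2 (by dsimp only; omega), by omega, h2, by dsimp only; omega⟩
        · exact Or.inl ⟨_, c.zFun_inl_bot (by omega), Or.inr ⟨by omega, by dsimp only; omega⟩⟩
    · intro y
      by_cases h1 : y.val < c.s
      · exact ⟨_, by rw [zFun, if_pos h1], Or.inl ⟨h1, rfl⟩⟩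
      · exact ⟨_, by rw [zFun, if_neg h1], Or.inr ⟨by dsimp only; omega, rfl⟩⟩
  refine ⟨?_, ?_, ?_⟩
  · rintro (x | y)
    · rcases z1 x with ⟨y, h1, h2⟩ | ⟨y, h1, h2⟩
      · obtain ⟨x', h3, h4⟩ := z2 y
        rw [h1, h3]; congr 1; exact Fin.ext (by omega)
      · rw [h1]
        exact c.zFun_inl_mid (by omega) (by omega) (by omega)
    · obtain ⟨x, h1, h2⟩ := z2 y
      rcases z1 x with ⟨y', h3, h4⟩ | ⟨y', h3, h4⟩
      · rw [h1, h3]; congr 1; exact Fin.ext (by omega)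
      · omega
  · rintro (x | y)
    · rcases z1 x with ⟨y, h1, h2⟩ | ⟨y, h1, h2⟩
      · simp [h1]
      · rw [h1]
        intro h
        have := congrArg Fin.val (Sum.inl_injective h)
        omega
    · obtain ⟨x, h1, h2⟩ := z2 y
      simp [h1]
  -- In perimeter positions each link is a reflection with one of three centres, so non-crossing
  -- reduces to linear arithmetic.
  · have hp : ∀ p : Point (n + k) d,
        (pos p < c.s ∧ pos p + pos (c.zFun p) + 1 = n + k + d ∨
        c.s ≤ pos p ∧ pos p < c.s + 2 * c.m ∧
          pos p + pos (c.zFun p) + 1 = 2 * c.s + 2 * c.m ∨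
        c.s + 2 * c.m ≤ pos p ∧ pos p + pos (c.zFun p) + 1 = n + k + d + 2 * c.m ∧
          pos (c.zFun p) ≥ c.s + 2 * c.m ∨
        c.s + 2 * c.m ≤ pos p ∧ pos p + pos (c.zFun p) + 1 = n + k + d ∧ pos (c.zFun p) < c.s) := by
      rintro (x | y)
      · rcases z1 x with ⟨y, h1, h2⟩ | ⟨y, h1, h2⟩ <;> rw [h1] <;>
          simp only [pos_inl, pos_inr] <;> omega
      · obtain ⟨x, h1, h2⟩ := z2 y
        rw [h1]
        simp only [pos_inl, pos_inr]
        omega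
    intro p p' h
    have h1 := hp p
    have h2 := hp p'
    omega

/-- The nested diagram. -/
def z : Monic (n + k) d :=
  ⟨⟨c.zFun, c.zFun_isPlanarMatching⟩, fun j => by
    by_cases h : j.val < c.s
    · exact ⟨_, by simp only [zFun, if_pos h]; rfl⟩
    · exact ⟨_, by simp only [zFun, if_neg h]; rfl⟩⟩

theorem z_apply (x : Point (n + k) d) : c.z.1.1 x = c.zFun x := rfl

theorem z_isNested : IsNested n k c.z := by
  have h1 := c.hN
  have h2 := c.he
  have h3 := c.hs
  refine ⟨c.m, h1, fun hm i hi a b ha hb => ?_, fun hm i hi a b ha hb => ?_⟩ <;>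
  exact c.zFun_inl_mid (by omega) (by omega) (by omega)

/-- The ends of an arc add up to `2 (s + m) - 1 = 2 (n - e) - 1`, less than the sum of two boundary
indices. -/
theorem z_noBoundaryArc : NoBoundaryArc n k c.z.1 := by
  intro a b ha hb hab
  have h3 := c.hs
  have h4 := c.hN
  have h5 := c.s_le
  rw [z_apply] at hab
  by_cases h1 : a.val < c.s
  · rw [c.zFun_inl_top h1] at hab
    exact Sum.inr_ne_inl hab
  · by_cases h2 : a.val < c.s + 2 * c.m
    · rw [c.zFun_inl_mid (y := ⟨2 * c.s + 2 * c.m - 1 - a.val, by omega⟩) (by omega) h2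
        (by dsimp only; omega)] at hab
      have := congrArg Fin.val (Sum.inl_injective hab)
      dsimp only at this
      omega
    · rw [c.zFun_inl_bot (by omega)] at hab
      exact Sum.inr_ne_inl hab

end NestedData

/-! ### Lowest through lines of a diagram without boundary arcs. -/

namespace NestedData

variable {n k d : ℕ} (c : NestedData n k d)

/-- The points outside of the lowest through lines of the nested diagram. -/
def IsUpper : Point (n + k) d → Prop
  | Sum.inl x => x.val + c.e < n + c.m
  | Sum.inr y => y.val < c.s

theorem isUpper_inl {x : Fin (n + k)} : c.IsUpper (Sum.inl x) ↔ x.val + c.e < n + c.m := Iff.rfl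

theorem isUpper_inr {y : Fin d} : c.IsUpper (Sum.inr y) ↔ y.val < c.s := Iff.rfl

section Links

variable {v : Monic (n + k) d}

/-- A boundary point joined to a bulk point is one of the first `m` boundary points. -/
theorem exists_inr_of_not_isUpper (hv : NoBoundaryArc n k v.1) {x : Fin (n + k)}
    (hx : ¬ c.IsUpper (Sum.inl x)) : ∃ j, v.1.1 (Sum.inl x) = Sum.inr j := by
  have hN := c.hN
  have he := c.he
  rw [isUpper_inl] at hx
  rcases hb : v.1.1 (Sum.inl x) with b | j
  swap
  · exact ⟨j, rfl⟩
  exfalso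
  have hbn : b.val < n := by
    by_contra h
    exact hv x b (by omega) (by omega) hb
  -- The boundary points from `n` up to `x` lie under the arc from `b` to `x`, so they are joined to
  -- left points too, necessarily in the bulk. There are at least `m + 1` of them, as `x` is not
  -- upper.
  have harc : ∀ i : Fin (c.m + 1), ∃ a : Fin (n + k),
      v.1.1 (Sum.inl ⟨n + i.val, by omega⟩) = Sum.inl a ∧ a.val < n := by
    intro i
    have key : ∃ a, v.1.1 (Sum.inl ⟨n + i.val, by omega⟩) = Sum.inl a := by
      by_cases hi : n + i.val = x.val
      · have hix : (⟨n + i.val, by omega⟩ : Fin (n + k)) = x := Fin.ext hi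
        exact ⟨b, by rw [hix, hb]⟩
      · have hm := v.1.pos_mem (x := Sum.inl b) (u := Sum.inl ⟨n + i.val, by omega⟩)
          (by simp only [pos_inl]; omega)
          (by rw [v.1.symm_apply hb]; simp only [pos_inl]; omega)
        rw [v.1.symm_apply hb] at hm
        rcases ha : v.1.1 (Sum.inl ⟨n + i.val, by omega⟩) with a | a
        · exact ⟨a, rfl⟩
        · simp only [ha, pos_inl, pos_inr] at hm
          omega
    obtain ⟨a, ha⟩ := key
    refine ⟨a, ha, ?_⟩
    by_contra h
    exact hv _ a (by dsimp only; omega) (by omega) ha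
  choose a ha han using harc
  choose g hg using v.2
  -- Together, `d` through lines and `m + 1` arcs would use `d + 2 (m + 1) > n + k` left points.
  let F : Fin d ⊕ (Fin (c.m + 1) ⊕ Fin (c.m + 1)) → Fin (n + k) :=
    Sum.elim g (Sum.elim (fun i => ⟨n + i.val, by omega⟩) a)
  have hF : Function.Injective F := by
    have hga : ∀ i j, g i ≠ a j := fun i j h => by
      have h1 := v.1.symm_apply (hg i)
      rw [h, v.1.symm_apply (ha j)] at h1
      exact Sum.inl_ne_inr h1
    have hgb : ∀ i (j : Fin (c.m + 1)), g i ≠ ⟨n + j.val, by omega⟩ := fun i j h => by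
      have h1 := v.1.symm_apply (hg i)
      rw [h, ha j] at h1
      exact Sum.inl_ne_inr h1
    have hba : ∀ (i : Fin (c.m + 1)) j, (⟨n + i.val, by omega⟩ : Fin (n + k)) ≠ a j := by
      intro i j h
      have := han j
      rw [← h] at this
      dsimp only at this
      omega
    rintro (i | i | i) (j | j | j) h
    · have h : g i = g j := h
      have h1 := hg i
      rw [h, ← hg j] at h1
      have h2 := Sum.inr_injective (v.1.injective h1)
      rw [h2]
    · exact absurd h (hgb i j)
    · exact absurd h (hga i j)
    · exact absurd h.symm (hgb j i)
    · have := congrArg Fin.val h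
      simp only [F, Sum.elim_inr, Sum.elim_inl] at this
      congr 2
      exact Fin.ext (by omega)
    · exact absurd h (hba i j)
    · exact absurd h.symm (hga j i)
    · exact absurd h.symm (hba j i)
    · have h : a i = a j := h
      have h1 := ha i
      rw [h, ← ha j] at h1
      have h2 := Sum.inl_injective (v.1.injective h1)
      have := congrArg Fin.val h2
      dsimp only at this
      congr 2
      exact Fin.ext (by omega)
  have := Fintype.card_le_of_injective F hF
  simp only [Fintype.card_sum, Fintype.card_fin] at this
  omega

/-- Induction from the bottom, with `t` lines already placed below. A partner below `y` is taken; a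
partner above `y` would force the line of `y` to start below `x`, where all starting points are
taken. -/
theorem through_of_not_isUpper (hv : NoBoundaryArc n k v.1) (t : ℕ) :
    ∀ (x : Fin (n + k)) (y : Fin d),
    ¬ c.IsUpper (Sum.inl x) → x.val + t + 1 = n + k → y.val + t + 1 = d →
      v.1.1 (Sum.inl x) = Sum.inr y := by
  induction t using Nat.strong_induction_on with
  | _ t ih =>
    intro x y hx hxt hyt
    obtain ⟨j, hj⟩ := c.exists_inr_of_not_isUpper hv hx
    rw [hj]
    congr 1
    have ih' : ∀ (x' : Fin (n + k)) (y' : Fin d), x < x' →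
        x'.val + d = y'.val + (n + k) → v.1.1 (Sum.inl x') = Sum.inr y' := by
      intro x' y' h1 h2
      rw [isUpper_inl] at hx
      exact ih (n + k - 1 - x'.val) (by omega) x' y' (by rw [isUpper_inl]; omega)
        (by omega) (by omega)
    have hN := c.hN
    rcases lt_trichotomy j y with h | h | h
    · obtain ⟨i, hi⟩ := v.2 y
      have h1 := v.1.through_lt (v.1.symm_apply hj) hi h
      have h2 := ih' i ⟨i.val - 2 * c.m, by omega⟩ h1 (by dsimp only; omega)
      rw [v.1.symm_apply hi] at h2
      have h3 := congrArg Fin.val (Sum.inr_injective h2)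
      dsimp only at h3
      omega
    · exact h
    · have h1 := ih' ⟨j.val + 2 * c.m, by omega⟩ j (Fin.lt_def.2 (by dsimp only; omega))
        (by dsimp only; omega)
      have h2 := hj
      rw [← h1] at h2
      have h3 := Sum.inl_injective (v.1.injective h2)
      have h4 := congrArg Fin.val h3
      dsimp only at h4
      omega

/-- The lowest through lines of `v` are those of the nested diagram. -/
theorem link_of_not_isUpper (hv : NoBoundaryArc n k v.1) {y : Point (n + k) d}
    (hy : ¬ c.IsUpper y) : v.1.1 y = c.zFun y ∧ ¬ c.IsUpper (c.zFun y) := by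
  have hN := c.hN
  have he := c.he
  have hs := c.hs
  rcases y with x | j
  · have hx := hy
    rw [isUpper_inl] at hx
    rw [c.zFun_inl_bot (by omega)]
    exact ⟨c.through_of_not_isUpper hv (n + k - 1 - x.val) x _ hy (by omega) (by dsimp only; omega),
      by rw [isUpper_inr]; dsimp only; omega⟩
  · rw [isUpper_inr] at hy
    have hx : ¬ c.IsUpper (Sum.inl ⟨j.val + 2 * c.m, by omega⟩) := by
      rw [isUpper_inl]; dsimp only; omega
    rw [zFun, if_neg hy]
    exact ⟨v.1.symm_apply (c.through_of_not_isUpper hv (d - 1 - j.val) _ j hx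
      (by dsimp only; omega) (by omega)), hx⟩

theorem isUpper_link (hv : NoBoundaryArc n k v.1) {y : Point (n + k) d}
    (hy : c.IsUpper y) : c.IsUpper (v.1.1 y) := by
  by_contra h
  obtain ⟨h1, h2⟩ := c.link_of_not_isUpper hv h
  rw [v.1.invol] at h1
  rw [← h1] at h2
  exact h2 hy

end Links

/-! ### The diagram carrying the nested diagram to a given one -/

/-- The bulk point of the transporting diagram that the point of the target stands for. -/
def toD : Point (n + k) d → Point (n + k) (n + k)
  | Sum.inl x =>
      if h : x.val < n then Sum.inl x
      -- From the boundary point `n`, the arc of `z` leads to `n - 1 - 2 e`, and the zigzag made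
      -- with the added right arcs leads on to `n - 1`. For `x > n` the arc of `z` alone leads to
      -- the point chosen below.
      else if x.val = n then Sum.inr ⟨n - 1, by have := c.hn; omega⟩
      else Sum.inr ⟨2 * n - 1 - 2 * c.e - x.val, by have := c.hn; omega⟩
  | Sum.inr y => Sum.inr ⟨y.val, by have := c.hN; omega⟩

/-- The point of the target that a bulk point of the transporting diagram stands for. -/
def ofD : Point (n + k) (n + k) → Point (n + k) d
  | Sum.inl x => Sum.inl x
  | Sum.inr r =>
      if h : r.val < c.s then Sum.inr ⟨r.val, h.trans_le c.s_le⟩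
      else if r.val < n - 1 - 2 * c.e then
        Sum.inl ⟨2 * n - 1 - 2 * c.e - r.val, by have := c.hs; have := c.he; have := c.hk; omega⟩
      else Sum.inl ⟨n, by have := c.hk; omega⟩

/-- The bulk points outside of the right arcs that are added. -/
def IsFree (p : Point (n + k) (n + k)) : Prop :=
  pos p < n ∨ pos p = n + 2 * k ∨ n + 2 * k + 2 * c.e < pos p

instance : DecidablePred c.IsFree := fun _ => inferInstanceAs (Decidable (_ ∨ _ ∨ _))

theorem isFree_inl {x : Fin (n + k)} : c.IsFree (Sum.inl x) ↔ x.val < n := by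
  simp only [IsFree, pos_inl]; omega

theorem isFree_inr {r : Fin (n + k)} :
    c.IsFree (Sum.inr r) ↔ r.val + 1 = n ∨ r.val + 1 + 2 * c.e < n := by
  have := c.he; have := c.hs; have := c.hk
  simp only [IsFree, pos_inr]; omega

theorem toD_ofD {p : Point (n + k) (n + k)} (hp : c.IsFree p) : c.toD (c.ofD p) = p := by
  have he := c.he; have hs := c.hs; have hk := c.hk; have hn := c.hn
  rcases p with x | r
  · rw [isFree_inl] at hp
    simp only [ofD, toD, dif_pos hp]
  · rw [isFree_inr] at hp
    rw [ofD]
    split_ifs with h1 h2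
    · rfl
    · simp only [toD]
      rw [dif_neg (by omega), if_neg (by omega)]
      congr 1; exact Fin.ext (by dsimp only; omega)
    · simp only [toD]
      rw [dif_neg (by omega), if_pos trivial]
      congr 1; exact Fin.ext (by dsimp only; omega)

theorem isUpper_ofD {p : Point (n + k) (n + k)} (hp : c.IsFree p) : c.IsUpper (c.ofD p) := by
  have he := c.he; have hs := c.hs; have hk := c.hk; have hn := c.hn
  rcases p with x | r
  · rw [isFree_inl] at hp
    rw [ofD, isUpper_inl]; omega
  · rw [isFree_inr] at hp
    rw [ofD]
    split_ifs with h1 h2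
    · exact h1
    · rw [isUpper_inl]; dsimp only; omega
    · rw [isUpper_inl]; dsimp only; omega

theorem isFree_toD {y : Point (n + k) d} (hy : c.IsUpper y) : c.IsFree (c.toD y) := by
  have he := c.he; have hs := c.hs; have hk := c.hk; have hn := c.hn
  rcases y with x | j
  · rw [isUpper_inl] at hy
    rw [toD]
    split_ifs with h1 h2
    · rw [isFree_inl]; exact h1
    · rw [isFree_inr]; dsimp only; omega
    · rw [isFree_inr]; dsimp only; omega
  · rw [isUpper_inr] at hy
    rw [toD, isFree_inr]; dsimp only; omega

theorem ofD_toD {y : Point (n + k) d} (hy : c.IsUpper y) : c.ofD (c.toD y) = y := by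
  have he := c.he; have hs := c.hs; have hk := c.hk; have hn := c.hn
  rcases y with x | j
  · rw [isUpper_inl] at hy
    rw [toD]
    split_ifs with h1 h2
    · rfl
    · simp only [ofD]
      by_cases h3 : c.e = 0
      · rw [dif_neg (by omega)]
        rw [if_neg (by omega)]
        congr 1; exact Fin.ext (by dsimp only; omega)
      · rw [dif_neg (by omega), if_neg (by omega)]
        congr 1; exact Fin.ext (by dsimp only; omega)
    · simp only [ofD]
      rw [dif_neg (by omega), if_pos (by omega)]
      congr 1; exact Fin.ext (by dsimp only; omega)
  · rw [isUpper_inr] at hy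
    simp only [toD, ofD, dif_pos hy]

theorem pos_ofD {p : Point (n + k) (n + k)} (hp : c.IsFree p) :
    pos (c.ofD p) = pos p ∧ pos p < n ∨ pos (c.ofD p) = n ∧ pos p = n + 2 * k ∧ c.s < n ∨
    pos (c.ofD p) + 2 * k + 2 * c.e = pos p ∧ n + 2 * k + 2 * c.e < pos p ∧
      pos p + c.s < 2 * n + 2 * k ∨
    pos (c.ofD p) + 2 * c.m = pos p ∧ n + 2 * k + 2 * c.e ≤ pos p ∧
      2 * n + 2 * k ≤ pos p + c.s := by
  have he := c.he; have hs := c.hs; have hk := c.hk; have hn := c.hn; have hN := c.hN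
  rcases p with x | r
  · rw [isFree_inl] at hp
    exact Or.inl ⟨rfl, hp⟩
  · rw [isFree_inr] at hp
    rw [ofD]
    split_ifs with h1 h2
    · simp only [pos_inr]; omega
    · simp only [pos_inl, pos_inr]; omega
    · exact Or.inr (Or.inl ⟨rfl, by rw [pos_inr]; omega, by omega⟩)

/-- The relabelling preserves the order along the perimeter, so non-crossing passes from the target
to the transporting diagram. -/
theorem pos_ofD_lt {p p' : Point (n + k) (n + k)} (hp : c.IsFree p) (hp' : c.IsFree p')
    (h : pos p < pos p') : pos (c.ofD p) < pos (c.ofD p') := by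
  have h1 := c.pos_ofD hp
  have h2 := c.pos_ofD hp'
  have he := c.he; have hs := c.hs; have hk := c.hk; have hn := c.hn; have hN := c.hN
  omega

/-- The links of the transporting diagram, for a target with links `f`. -/
def dFun (f : Point (n + k) d → Point (n + k) d) (p : Point (n + k) (n + k)) :
    Point (n + k) (n + k) :=
  if c.IsFree p then c.toD (f (c.ofD p))
  else match p with
    | Sum.inl x => Sum.inr x
    | Sum.inr r =>
        -- The added arcs are nested on the `2 e` right points `n - 1 - 2 e, …, n - 2`, one place
        -- higher than the bulk arcs of `z`; the point `n - 1` is free.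
        if h : r.val < n ∧ n ≤ r.val + 2 * c.e + 1 then
          Sum.inr ⟨2 * n - 3 - 2 * c.e - r.val, by omega⟩
        else Sum.inl r

section

variable (f : Point (n + k) d → Point (n + k) d)

theorem dFun_of_isFree {p : Point (n + k) (n + k)} (hp : c.IsFree p) :
    c.dFun f p = c.toD (f (c.ofD p)) := if_pos hp

theorem dFun_inl {x : Fin (n + k)} (hx : n ≤ x.val) : c.dFun f (Sum.inl x) = Sum.inr x := by
  rw [dFun, if_neg (by rw [isFree_inl]; omega)]

theorem dFun_inr {x : Fin (n + k)} (hx : n ≤ x.val) : c.dFun f (Sum.inr x) = Sum.inl x := by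
  rw [dFun, if_neg (by rw [isFree_inr]; omega)]
  exact dif_neg (by omega)

theorem dFun_arc {r r' : Fin (n + k)} (h : r.val + r'.val + 3 + 2 * c.e = 2 * n)
    (h1 : r.val + 2 ≤ n) (h2 : r'.val + 2 ≤ n) : c.dFun f (Sum.inr r) = Sum.inr r' := by
  rw [dFun, if_neg (by rw [isFree_inr]; omega)]
  refine (dif_pos (by omega)).trans ?_
  congr 1; exact Fin.ext (by dsimp only; omega)

theorem cases_not_isFree {p : Point (n + k) (n + k)} (hp : ¬ c.IsFree p) :
    (∃ x : Fin (n + k), n ≤ x.val ∧ (p = Sum.inl x ∨ p = Sum.inr x)) ∨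
    ∃ r r' : Fin (n + k), p = Sum.inr r ∧ r.val + r'.val + 3 + 2 * c.e = 2 * n ∧ r.val + 2 ≤ n ∧
      r'.val + 2 ≤ n := by
  have he := c.he; have hs := c.hs; have hk := c.hk; have hn := c.hn
  rcases p with x | r
  · rw [isFree_inl] at hp
    exact Or.inl ⟨x, by omega, Or.inl rfl⟩
  · rw [isFree_inr] at hp
    by_cases h : n ≤ r.val
    · exact Or.inl ⟨r, h, Or.inr rfl⟩
    · exact Or.inr ⟨r, ⟨2 * n - 3 - 2 * c.e - r.val, by omega⟩, rfl, by dsimp only; omega, by omega,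
        by dsimp only; omega⟩

/-- The position of the other end of a link that is not free. -/
theorem pos_dFun {p : Point (n + k) (n + k)} (hp : ¬ c.IsFree p) :
    ¬ c.IsFree (c.dFun f p) ∧ c.dFun f (c.dFun f p) = p ∧ c.dFun f p ≠ p ∧
    (n ≤ pos p ∧ pos p < n + 2 * k ∧ pos p + pos (c.dFun f p) + 1 = 2 * n + 2 * k ∨
    n + 2 * k < pos p ∧ pos p ≤ n + 2 * k + 2 * c.e ∧
      pos p + pos (c.dFun f p) = 2 * n + 4 * k + 1 + 2 * c.e) := by
  have he := c.he; have hs := c.hs; have hk := c.hk; have hn := c.hn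
  rcases c.cases_not_isFree hp with ⟨x, hx, rfl | rfl⟩ | ⟨r, r', rfl, h1, h2, h3⟩
  · rw [c.dFun_inl f hx, c.dFun_inr f hx, isFree_inr]
    simp only [pos_inl, pos_inr]
    exact ⟨by omega, trivial, by simp, by omega⟩
  · rw [c.dFun_inr f hx, c.dFun_inl f hx, isFree_inl]
    simp only [pos_inl, pos_inr]
    exact ⟨by omega, trivial, by simp, by omega⟩
  · rw [c.dFun_arc f h1 h2 h3, c.dFun_arc f (r' := r) (by omega) h3 h2, isFree_inr]
    simp only [pos_inr]
    refine ⟨by omega, trivial, fun h => ?_, by omega⟩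
    have := congrArg Fin.val (Sum.inr_injective h)
    omega

end

/-- Free links copy those of `v`. The others are reflections of two perimeter intervals that contain
no free point, so they are nested and cannot meet a free link. -/
theorem dFun_isPlanarMatching (v : Diagram (n + k) d) (hv : ∀ y, c.IsUpper y → c.IsUpper (v.1 y)) :
    IsPlanarMatching (c.dFun v.1) := by
  have hfree : ∀ {p}, c.IsFree p → c.IsFree (c.dFun v.1 p) ∧
      c.ofD (c.dFun v.1 p) = v.1 (c.ofD p) := by
    intro p hp
    have h := hv _ (c.isUpper_ofD hp)
    rw [c.dFun_of_isFree _ hp]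
    exact ⟨c.isFree_toD h, c.ofD_toD h⟩
  refine ⟨fun p => ?_, fun p => ?_, ?_⟩
  · by_cases hp : c.IsFree p
    · obtain ⟨h1, h2⟩ := hfree hp
      rw [c.dFun_of_isFree _ h1, h2, v.invol, c.toD_ofD hp]
    · exact (c.pos_dFun v.1 hp).2.1
  · by_cases hp : c.IsFree p
    · obtain ⟨h1, h2⟩ := hfree hp
      intro h
      rw [h] at h2
      exact v.ne_self _ h2.symm
    · exact (c.pos_dFun v.1 hp).2.2.1
  · rintro p p' ⟨h1, h2, h3⟩
    by_cases hp : c.IsFree p <;> by_cases hp' : c.IsFree p'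
    · obtain ⟨a1, a2⟩ := hfree hp
      obtain ⟨b1, b2⟩ := hfree hp'
      refine v.not_cross (c.ofD p) (c.ofD p') ⟨c.pos_ofD_lt hp hp' h1, ?_, ?_⟩
      · rw [← a2]; exact c.pos_ofD_lt hp' a1 h2
      · rw [← a2, ← b2]; exact c.pos_ofD_lt a1 b1 h3
    · have a1 := (hfree hp).1
      have b := (c.pos_dFun v.1 hp').2.2.2
      rw [IsFree] at hp a1
      omega
    · have b1 := (hfree hp').1
      have a := (c.pos_dFun v.1 hp).2.2.2
      rw [IsFree] at hp' b1
      omega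
    · have a := (c.pos_dFun v.1 hp).2.2.2
      have b := (c.pos_dFun v.1 hp').2.2.2
      omega

section Transport

variable {v : Monic (n + k) d} (hv : NoBoundaryArc n k v.1)

/-- The diagram, straight on the boundary, that carries the nested diagram to `v`. -/
def transport : Diagram (n + k) (n + k) :=
  ⟨c.dFun v.1.1, c.dFun_isPlanarMatching v.1 fun _ => c.isUpper_link hv⟩

theorem transport_apply (p : Point (n + k) (n + k)) : (c.transport hv).1 p = c.dFun v.1.1 p := rfl

theorem transport_straight : IsStraightOnBoundary n k (c.transport hv) :=
  fun _ hi => c.dFun_inl _ hi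

theorem reach_z {x y : Fin (n + k)} (h : c.s ≤ x.val) (h' : x.val < c.s + 2 * c.m)
    (hxy : x.val + y.val + 1 = 2 * c.s + 2 * c.m) :
    (glued (c.transport hv) c.z.1).Reachable (Sum.inr (Sum.inl x)) (Sum.inr (Sum.inl y)) :=
  reach_right_of _ (c.zFun_inl_mid h h' hxy)

/-- An arc of `z` followed by an added arc moves up by two points, since their centres are one place
apart. -/
theorem reach_chain (j : ℕ) (hj : j ≤ c.e) : ∀ x y : Fin (n + k), x.val + 1 = n →
    y.val + 2 * j + 1 = n →
    (glued (c.transport hv) c.z.1).Reachable (Sum.inr (Sum.inl x)) (Sum.inr (Sum.inl y)) := by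
  have he := c.he; have hs := c.hs; have hk := c.hk; have hn := c.hn
  induction j with
  | zero =>
    intro x y hx hy
    rw [Fin.ext (by omega : x.val = y.val)]
  | succ j ih =>
    intro x y hx hy
    refine (ih (by omega) x ⟨y.val + 2, by omega⟩ hx (by dsimp only; omega)).trans ?_
    refine (c.reach_z hv (y := ⟨n - 2 * c.e + 2 * j, by omega⟩) (by dsimp only; omega)
      (by dsimp only; omega) (by dsimp only; omega)).trans ?_
    exact reach_left_of (x := Sum.inr _) (y := Sum.inr y) c.z.1
      (c.dFun_arc _ (by dsimp only; omega) (by dsimp only; omega) (by omega))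

theorem reach_toD {y : Point (n + k) d} (hy : c.IsUpper y) :
    (glued (c.transport hv) c.z.1).Reachable (outerV y) (leftV (c.toD y)) := by
  have he := c.he; have hs := c.hs; have hk := c.hk; have hn := c.hn
  rcases y with x | j
  · rw [isUpper_inl] at hy
    rw [toD]
    split_ifs with h1 h2
    · exact SimpleGraph.Reachable.refl _
    · have r1 := c.reach_chain hv c.e le_rfl ⟨n - 1, by omega⟩ ⟨n - 1 - 2 * c.e, by omega⟩
        (by dsimp only; omega) (by dsimp only; omega)
      have r2 := c.reach_z hv (x := ⟨n - 1 - 2 * c.e, by omega⟩) (y := x) (by dsimp only; omega)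
        (by dsimp only; omega) (by dsimp only; omega)
      exact (reach_left_of (x := Sum.inl x) (y := Sum.inr x) c.z.1
        (c.dFun_inl _ (by omega))).trans (r1.trans r2).symm
    · exact (reach_left_of (x := Sum.inl x) (y := Sum.inr x) c.z.1
        (c.dFun_inl _ (by omega))).trans (c.reach_z hv (by omega) (by omega)
          (by dsimp only; omega))
  · rw [isUpper_inr] at hy
    refine (reach_right_of (x := Sum.inl ⟨j.val, by have := c.hN; omega⟩) (y := Sum.inr j)
      _ ?_).symm
    exact c.zFun_inl_top hy

/-- An upper link of `v` is a link of the transporting diagram, extended at its ends by `reach_toD`.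
A lowest through line runs straight along the boundary and then along a through line of `z`. -/
theorem concat_transport : concat (c.transport hv) c.z.1 = v.1 := by
  refine Subtype.ext (funext fun y => concat_apply (v.1.ne_self y).symm ?_)
  by_cases hy : c.IsUpper y
  · refine ((c.reach_toD hv hy).trans ?_).trans (c.reach_toD hv (c.isUpper_link hv hy)).symm
    refine reach_left_of _ ?_
    rw [transport_apply, c.dFun_of_isFree _ (c.isFree_toD hy), c.ofD_toD hy]
  · have key : ∀ x : Fin (n + k), ¬ c.IsUpper (Sum.inl x) →
        (glued (c.transport hv) c.z.1).Reachable (outerV (Sum.inl x))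
          (outerV (v.1.1 (Sum.inl x))) := by
      intro x hx
      have h1 := (c.link_of_not_isUpper hv hx).1
      obtain ⟨j, hj⟩ := c.exists_inr_of_not_isUpper hv hx
      have he := c.he; have hs := c.hs; have hk := c.hk; have hn := c.hn
      rw [isUpper_inl] at hx
      refine (reach_left_of (x := Sum.inl x) (y := Sum.inr x) c.z.1
        (c.dFun_inl _ (by omega))).trans ?_
      rw [hj]
      exact reach_right_of _ (h1.symm.trans hj)
    rcases y with x | j
    · exact key x hy
    · obtain ⟨x, hx⟩ := v.2 j
      obtain ⟨h1, h2⟩ := c.link_of_not_isUpper hv hy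
      rw [← h1, hx] at h2
      have := key x h2
      rw [v.1.symm_apply hx] at this
      rw [hx]
      exact this.symm

theorem loops_transport : loops (c.transport hv) c.z.1 = 0 := by
  have he := c.he; have hs := c.hs; have hk := c.hk; have hn := c.hn
  have hfree : ∀ j : Fin (n + k), c.IsFree (Sum.inr j) → ∃ x : Point (n + k) d,
      (glued (c.transport hv) c.z.1).Reachable (Sum.inr (Sum.inl j)) (outerV x) := by
    intro j hj
    have := (c.reach_toD hv (c.isUpper_ofD hj)).symm
    rw [c.toD_ofD hj] at this
    exact ⟨_, this⟩
  refine loops_eq_zero fun j => ?_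
  by_cases hj : c.IsFree (Sum.inr j)
  · exact hfree j hj
  rcases c.cases_not_isFree hj with ⟨x, hx, h | h⟩ | ⟨r, r', h, h1, h2, h3⟩
  · exact absurd h (by simp)
  · obtain rfl := Sum.inr_injective h
    exact ⟨Sum.inl j, reach_left_of (x := Sum.inr j) (y := Sum.inl j) _ (c.dFun_inr _ hx)⟩
  · obtain rfl := Sum.inr_injective h
    obtain ⟨y, hy⟩ := hfree ⟨n - 1, by omega⟩ (by rw [isFree_inr]; dsimp only; omega)
    refine ⟨y, SimpleGraph.Reachable.trans ?_ hy⟩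
    -- A point at even distance from `n - 1` is on the zigzag already. At odd distance, one arc of
    -- `z` leads to a point at even distance.
    rcases Nat.even_or_odd' (n - 1 - j.val) with ⟨i, hi | hi⟩
    · exact (c.reach_chain hv i (by omega) _ j (by dsimp only; omega) (by omega)).symm
    · refine (c.reach_z hv (y := ⟨2 * n - 1 - 2 * c.e - j.val, by omega⟩) (by omega) (by omega)
        (by dsimp only; omega)).trans ?_
      exact (c.reach_chain hv (c.e - 1 - i) (by omega) _ _ (by dsimp only; omega)
        (by dsimp only; omega)).symm

end Transport

end NestedData

/-! ### Generators of the cellular modules of the seam algebra. -/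

section SeamModule

variable {n k d : ℕ} {q : ℂ}

theorem act_seamProj_mem (x : Cell (n + k) d) :
    act (q + q⁻¹) (seamProj q n k) x ∈ seamCell q n k d := by
  rw [act_eq]
  induction x using Finsupp.induction_linear with
  | zero => rw [map_zero]; exact zero_mem _
  | add x y hx hy => rw [map_add]; exact add_mem hx hy
  | single w a =>
    rw [← mul_one a, ← smul_eq_mul, ← Finsupp.smul_single, map_smul]
    refine Submodule.smul_mem _ _ ?_
    by_cases h : seamVec q n k w = 0
    · rw [← act_eq, ← seamVec, h]; exact zero_mem _
    · exact Submodule.subset_span ⟨h, w, rfl⟩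

theorem act_sandwich (a : TL (n + k)) (x : Cell (n + k) d) :
    act (q + q⁻¹) (sandwich q n k a) x = act (q + q⁻¹) (seamProj q n k)
      (act (q + q⁻¹) a (act (q + q⁻¹) (seamProj q n k) x)) := by
  rw [act_act, act_act, sandwich, comp_assoc]

theorem isGenerator_of_forall {z : seamCell q n k d} (h : ∀ x ∈ seamCell q n k d,
    ∃ a, act (q + q⁻¹) (sandwich q n k a) (z : Cell (n + k) d) = x) : IsGenerator q z := by
  refine Set.Subset.antisymm ?_ fun x hx => ?_
  · rintro x ⟨_, ⟨a, rfl⟩, rfl⟩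
    rw [act_sandwich]
    exact act_seamProj_mem _
  · obtain ⟨a, ha⟩ := h x hx
    exact ⟨_, ⟨a, rfl⟩, ha⟩

theorem act_seamProj_act (hq0 : q ≠ 0) (hn : 1 ≤ n) (hk : 2 ≤ k)
    (hq : ∀ l : ℕ, 0 < l → q ^ (2 * l) = 1 → k < l) (x : Cell (n + k) d) :
    act (q + q⁻¹) (seamProj q n k) (act (q + q⁻¹) (seamProj q n k) x) =
      act (q + q⁻¹) (seamProj q n k) x := by
  rw [act_act, seamProj_idem hq0 hn hk hq]

theorem act_seamProj_of_mem (hq0 : q ≠ 0) (hn : 1 ≤ n) (hk : 2 ≤ k)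
    (hq : ∀ l : ℕ, 0 < l → q ^ (2 * l) = 1 → k < l) {x : Cell (n + k) d}
    (hx : x ∈ seamCell q n k d) : act (q + q⁻¹) (seamProj q n k) x = x := by
  rw [act_eq]
  induction hx using Submodule.span_induction with
  | mem x hx =>
    obtain ⟨-, w, rfl⟩ := hx
    exact act_seamProj_act hq0 hn hk hq _
  | zero => rw [map_zero]
  | add x y _ _ hx hy => rw [map_add, hx, hy]
  | smul a x _ hx => rw [map_smul, hx]

/-- Every element outside of the radical generates the module. -/
theorem isGenerator_of_notMem_radical (hq0 : q ≠ 0) (hn : 1 ≤ n) (hk : 2 ≤ k)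
    (hq : ∀ l : ℕ, 0 < l → q ^ (2 * l) = 1 → k < l) {z : seamCell q n k d}
    (hz : z ∉ seamRadical q n k d) : IsGenerator q z := by
  simp only [seamRadical, Set.mem_ofPred_eq, not_forall] at hz
  obtain ⟨y, hy⟩ := hz
  rw [seamForm, form_comm] at hy
  -- The rank one operator `x y*`, normalised by `⟨y, z⟩`, sends `z` to `x`.
  refine isGenerator_of_forall fun x hx =>
    ⟨(form (q + q⁻¹) (y : Cell (n + k) d) z)⁻¹ •
      comp (q + q⁻¹) (incl _ _ x) (mirrorHom (incl _ _ (y : Cell (n + k) d))), ?_⟩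
  rw [act_sandwich, act_seamProj_of_mem hq0 hn hk hq z.2, act_eq _ (_ • _), map_smul,
    LinearMap.smul_apply, ← act_eq, act_comp_mirror, smul_smul, inv_mul_cancel₀ hy, one_smul,
    act_seamProj_of_mem hq0 hn hk hq hx]

/-- A diagram that is straight on the boundary acts on the module as on diagrams. -/
theorem act_sandwich_seamVec (hq0 : q ≠ 0) (hn : 1 ≤ n) (hk : 2 ≤ k)
    (hq : ∀ l : ℕ, 0 < l → q ^ (2 * l) = 1 → k < l) {D : Diagram (n + k) (n + k)}
    (hD : IsStraightOnBoundary n k D) {z v : Monic (n + k) d} (hc : concat D z.1 = v.1)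
    (hl : loops D z.1 = 0) :
    act (q + q⁻¹) (sandwich q n k (Finsupp.single D 1)) (seamVec q n k z) = seamVec q n k v := by
  have h : act (q + q⁻¹) (Finsupp.single D 1) (Finsupp.single z 1) = Finsupp.single v (1 : ℂ) := by
    rw [act, incl_single, comp_single, hc, hl, monicPart_single]
    simp
  rw [act_sandwich, seamVec, act_seamProj_act hq0 hn hk hq, act_act (q + q⁻¹) (Finsupp.single D 1),
    seamProj_comm hn hk hD, ← act_act, h, act_seamProj_act hq0 hn hk hq, seamVec]

theorem seamVec_z_mem (c : NestedData n k d) : seamVec q n k c.z ∈ seamBasis q n k d :=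
  ⟨seamVec_ne_zero c.hn c.hk c.z_noBoundaryArc, c.z, rfl⟩

theorem exists_transport (hq0 : q ≠ 0) (hq : ∀ l : ℕ, 0 < l → q ^ (2 * l) = 1 → k < l)
    (c : NestedData n k d) {v : Monic (n + k) d} (hv : seamVec q n k v ∈ seamBasis q n k d) :
    ∃ D : Diagram (n + k) (n + k), IsStraightOnBoundary n k D ∧ IsConcat D c.z.1 v.1 ∧
      loops D c.z.1 = 0 ∧ act (q + q⁻¹) (sandwich q n k (Finsupp.single D 1)) (seamVec q n k c.z) =
        seamVec q n k v := by
  have hv := noBoundaryArc_of_seamVec_ne_zero hq0 c.hn c.hk hq hv.1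
  have hc := c.concat_transport hv
  have hs := c.transport_straight hv
  refine ⟨c.transport hv, hs, ?_, c.loops_transport hv,
    act_sandwich_seamVec hq0 c.hn c.hk hq hs hc (c.loops_transport hv)⟩
  rw [← hc]
  exact isConcat_concat _ _

/-- The orbit of `P_k z` is a linear space that contains every spanning vector `P_k v`, whether or
not the form vanishes. -/
theorem isGenerator_z (hq0 : q ≠ 0) (hq : ∀ l : ℕ, 0 < l → q ^ (2 * l) = 1 → k < l)
    (c : NestedData n k d) : IsGenerator q
      (⟨seamVec q n k c.z, Submodule.subset_span (seamVec_z_mem c)⟩ : seamCell q n k d) := by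
  refine isGenerator_of_forall fun x hx => ?_
  induction hx using Submodule.span_induction with
  | mem x hx =>
    obtain ⟨h0, v, rfl⟩ := hx
    obtain ⟨D, -, -, -, h⟩ := exists_transport hq0 hq c ⟨h0, v, rfl⟩
    exact ⟨_, h⟩
  | zero => 
    exact ⟨0, by rw [act_sandwich, act_eq _ 0, map_zero, LinearMap.zero_apply, act_eq, map_zero]⟩
  | add x y _ _ hx hy =>
    obtain ⟨a, rfl⟩ := hx
    obtain ⟨b, rfl⟩ := hy
    exact ⟨a + b, by simp only [sandwich, act_eq, map_add, LinearMap.add_apply]⟩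
  | smul r x _ hx =>
    obtain ⟨a, rfl⟩ := hx
    exact ⟨r • a, by simp only [sandwich, act_eq, map_smul, LinearMap.smul_apply]⟩

end SeamModule

end Seam
end

open Seam
theorem mainTheorem8 (n k : ℕ) (hn : 1 ≤ n) (hk : 2 ≤ k) (q : ℂ) (hq0 : q ≠ 0)
    (hq : ∀ l : ℕ, 0 < l → q ^ (2 * l) = 1 → k < l)
    (d : ℕ) (hd : d ∈ seamIndex n k) :
    (∃ z : seamCell q n k d, IsGenerator q z) ∧
    ((∃ x y : seamCell q n k d, seamForm q x y ≠ 0) →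
      ∀ z : seamCell q n k d, z ∉ seamRadical q n k d → IsGenerator q z) ∧
    ((∀ x y : seamCell q n k d, seamForm q x y = 0) →
      ∃ z : Monic (n + k) d, IsNested n k z ∧
        ∃ hz : seamVec q n k z ∈ seamBasis q n k d,
          IsGenerator q (⟨seamVec q n k z, Submodule.subset_span hz⟩ : seamCell q n k d) ∧
          ∀ v : Monic (n + k) d, seamVec q n k v ∈ seamBasis q n k d →
            ∃ D : Diagram (n + k) (n + k),
              IsStraightOnBoundary n k D ∧ IsConcat D z.1 v.1 ∧ loops D z.1 = 0 ∧
              act (q + q⁻¹) (sandwich q n k (Finsupp.single D 1)) (seamVec q n k z) =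
                seamVec q n k v) := by
  obtain ⟨c⟩ := NestedData.exists_of_mem hn hk hd
  exact ⟨⟨_, isGenerator_z hq0 hq c⟩, fun _ z hz => isGenerator_of_notMem_radical hq0 hn hk hq hz,
    fun _ => ⟨c.z, c.z_isNested, seamVec_z_mem c, isGenerator_z hq0 hq c,
      fun _ hv => exists_transport hq0 hq c hv⟩⟩
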